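/- All graphs are finite, simple and undirected; $|G|$ is the number of vertices of $G$, $N(v)$ is the set of neighbours of a vertex $v$, and $\deg(G)=\{\deg(v)\mid v\in V(G)\}$. For a graph $G$, Colour Refinement computes the vertex colourings $\chi^0_G,\chi^1_G,\dots$, where $\chi^0_G$ is constant and $$\chi^{i+1}_G(v)=\bigl(\chi^{i}_G(v),\{\!\{\chi^{i}_G(w)\mid w\in N(v)\}\!\}\bigr),$$ the second component being a multiset. Let $\mathrm{WL}_1(G)$ be the least $j\ge 0$ such that $\chi^j_G$ and $\chi^{j+1}_G$ induce the same partition of $V(G)$ into colour classes. The graph $G$ is a long-refinement graph if $\mathrm{WL}_1(G)=|G|-1$. (a) For every even $n\ge 12$ such that $n=12$ or $n \bmod 18\notin\{6,12\}$, there is a long-refinement graph $G$ with $|G|=n$ and $\deg(G)=\{2,3\}$. (b) For every odd $n\ge 11$ with $n \bmod 18\notin\{3,9\}$, there is a long-refinement graph $G$ with $|G|=n$ and $\deg(G)=\{2,3\}$. (c) Consequently, for every $n\ge 11$ such that $n=12$ or $n \bmod 18\notin\{3,6,9,12\}$, there is a long-refinement graph $G$ with $|G|=n$ and $\deg(G)=\{2,3\}$.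 -/

import Mathlib

/-- Colours after `i` rounds, for initial colours in `C`: a colour of round `i + 1` is a pair
consisting of a colour of round `i` and a multiset of colours of round `i`. -/
def RefinedColour (C : Type*) : ℕ → Type _
  | 0 => C
  | i + 1 => RefinedColour C i × Multiset (RefinedColour C i)

/-- The colouring `χ^i` computed by `i` iterations of Colour Refinement on the graph `G` with
initial colouring `c`: `χ^0 = c`, and `χ^(i+1) v` is the pair of `χ^i v` and the multiset of the
`χ^i w`, where `w` ranges over the neighbours of `v`. -/
def colourRefinement {V C : Type*} [Fintype V] (G : SimpleGraph V) [DecidableRel G.Adj]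
    (c : V → C) : (i : ℕ) → V → RefinedColour C i
  | 0 => c
  | i + 1 => fun v =>
      (colourRefinement G c i v, (G.neighborFinset v).val.map (colourRefinement G c i))

/-- The partition of the vertex set into colour classes of `χ^i`, as an equivalence relation. -/
def colourPartition {V C : Type*} [Fintype V] (G : SimpleGraph V) [DecidableRel G.Adj]
    (c : V → C) (i : ℕ) : Setoid V :=
  Setoid.ker (colourRefinement G c i)

/-- Each round refines the partition of the previous one. -/
theorem colourPartition_succ_le {V C : Type*} [Fintype V] (G : SimpleGraph V)
    [DecidableRel G.Adj] (c : V → C) (i : ℕ) :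
    colourPartition G c (i + 1) ≤ colourPartition G c i := by
  intro u v h
  exact congrArg Prod.fst (h : (_, _) = (_, _))

/-- On a finite graph the partition becomes stable. -/
theorem exists_colourPartition_stable {V C : Type*} [Fintype V] (G : SimpleGraph V)
    [DecidableRel G.Adj] (c : V → C) :
    ∃ j : ℕ, colourPartition G c j = colourPartition G c (j + 1) := by
  have hinj : Function.Injective (fun s : Setoid V => (s : V → V → Prop)) := by
    intro s t h
    exact Setoid.ext fun a b => iff_of_eq (congrFun (congrFun h a) b)
  have : Finite (Setoid V) := Finite.of_injective _ hinj
  by_contra! hne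
  have hanti : StrictAnti (colourPartition G c) :=
    strictAnti_nat_of_succ_lt fun i =>
      lt_of_le_of_ne (colourPartition_succ_le G c i) (hne i).symm
  exact not_injective_infinite_finite _ hanti.injective

open Classical in
/-- The number of iterations of Colour Refinement on a graph with initial colouring `c`: the
least `j` such that `χ^j` and `χ^(j+1)` induce the same partition of the vertex set. -/
noncomputable def iterationNumber {V C : Type*} [Fintype V] (G : SimpleGraph V)
    [DecidableRel G.Adj] (c : V → C) : ℕ :=
  Nat.find (exists_colourPartition_stable G c)

/-- `WL₁(G)` for an uncoloured graph: the initial colouring is monochromatic. -/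
noncomputable def wlOne {V : Type*} [Fintype V] (G : SimpleGraph V) [DecidableRel G.Adj] : ℕ :=
  iterationNumber G (fun _ : V => ())

/-- A long-refinement graph: `WL₁(G) = |G| - 1` (written without truncated subtraction). -/
def IsLongRefinement {V : Type*} [Fintype V] (G : SimpleGraph V) [DecidableRel G.Adj] : Prop :=
  wlOne G + 1 = Fintype.card V

/-- The set `deg(G)` of vertex degrees of `G`. -/
def degreeSet {V : Type*} [Fintype V] (G : SimpleGraph V) [DecidableRel G.Adj] : Set ℕ :=
  Set.range fun v : V => G.degree v

/-- There is a long-refinement graph with `n` vertices whose set of vertex degrees is `{2, 3}`. -/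
def ExistsLongRefinementTwoThree (n : ℕ) : Prop :=
  ∃ (V : Type) (_ : Fintype V) (G : SimpleGraph V) (_ : DecidableRel G.Adj),
    Fintype.card V = n ∧ IsLongRefinement G ∧ degreeSet G = {2, 3}

/-! Refinement starts with one class and ends with at most $n$, so $n-1$ effective rounds mean that
every round splits exactly one class into two, until all classes are singletons. Such a run is
encoded by a linear order in which all classes are intervals, with a time attached to each cut
between consecutive vertices; the times are a bijection onto $\{1,\dots,n-1\}$. `SplitCertificate`
lists local conditions on order and times: a cut must not happen too early (the two neighbourhoods
still match) and must not happen too late (the cut of the previous round tells them apart). By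
induction on the rounds (`SplitCertificate.colour_eq_iff`) two vertices have the same colour after
`t` rounds iff no cut of time at most `t` lies between them, and `SplitCertificate.isLongRefinement`
follows.

The graphs of the infinite families consist of pairs of vertices strung together by matchings. As
long as no pair is split, refinement takes place on the quotient multigraph whose nodes are the
pairs. The two vertices of the pair `0` are attached to different pairs `x₁` and `x₂`, which the
quotient separates only in its last round. This splits the pair `0`, and the splitting then runs
along the string, one pair per round. Hence (`PairString.lift_certificate`) it is enough to find
quotients on `N` nodes that need `N - 1` rounds, with the last cut between `x₁` and `x₂`.

In both families the string is bent into three arms, so that a typical level contains one pair of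
each arm. In a first phase the levels are separated from each other; in a second phase the nodes
within the levels are separated, one cut per round, down the first arm and up the second. In
`PairString.fold` only the innermost level has degree two, and the levels peel off one after the
other. A level has six vertices, and the variants at the bend and at the top give the residues 1, 2,
4, 5 modulo 6. In `PairString.weave` every third level has degree two, and the cuts among these
levels and among the remaining ones trigger each other. The pattern has period three levels, that is
18 vertices, and gives the residues 0 and 15 modulo 18. The order 12 is settled by a single graph
and a finite check. -/

/-! ### Certificates for refinements that split one class per round -/

/-- `p` and `q` are not separated by any cut of time at most `t`: nodes are ordered by the rank `ρ`,
and the cut right after `x` in this order has time `τ x`. -/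
def Linked (N : ℕ) (ρ τ : ℕ → ℕ) (t p q : ℕ) : Prop :=
  ∀ x < N, min (ρ p) (ρ q) ≤ ρ x → ρ x < max (ρ p) (ρ q) → t < τ x

/-- A certificate that Colour Refinement on the (multi)graph on `{0, …, N - 1}` with neighbour lists
`nb` splits exactly one class into two in each round. The nodes are ordered by `ρ`, the successor
of `p` is `nx p`, the last node is `z`, and the classes after `t` rounds are the maximal intervals
without a cut of time at most `t`. -/
structure SplitCertificate (N : ℕ) (nb : ℕ → List ℕ) (ρ τ nx : ℕ → ℕ) (z : ℕ) : Prop where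
  last_lt : z < N
  rank_inj : ∀ p < N, ∀ q < N, ρ p = ρ q → p = q
  rank_le_last : ∀ p < N, ρ p ≤ ρ z
  next_lt : ∀ p < N, p ≠ z → nx p < N
  lt_rank_next : ∀ p < N, p ≠ z → ρ p < ρ (nx p)
  rank_next_le : ∀ p < N, p ≠ z → ∀ x < N, ρ p < ρ x → ρ (nx p) ≤ ρ x
  time_pos : ∀ p < N, p ≠ z → 0 < τ p
  time_lt : ∀ p < N, p ≠ z → τ p < N
  time_inj : ∀ p < N, p ≠ z → ∀ q < N, q ≠ z → τ p = τ q → p = q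
  -- To share a colour up to round `τ p - 1`, the nodes `p` and `nx p` need neighbours that match in
  -- round `τ p - 2`. For `τ p = 1` nothing is needed, as the initial colouring is constant.
  matched : ∀ p < N, p ≠ z → 2 ≤ τ p →
    Multiset.Rel (Linked N ρ τ (τ p - 2)) (nb p : Multiset ℕ) (nb (nx p) : Multiset ℕ)
  -- The first cut comes from degrees. Every later one is caused by the unique cut of the previous
  -- round: the two nodes have different numbers of neighbours on its lower side.
  unmatched : ∀ p < N, p ≠ z → (τ p = 1 ∧ (nb p).length ≠ (nb (nx p)).length) ∨
    ∃ x < N, x ≠ z ∧ τ x + 1 = τ p ∧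
      (nb p).countP (fun w => decide (ρ w ≤ ρ x)) ≠
        (nb (nx p)).countP (fun w => decide (ρ w ≤ ρ x))

section Linked

variable {N : ℕ} {ρ τ : ℕ → ℕ} {s t p q r : ℕ}

theorem Linked.symm (h : Linked N ρ τ t p q) : Linked N ρ τ t q p := by
  intro x hx h1 h2
  exact h x hx (by rwa [min_comm]) (by rwa [max_comm])

theorem Linked.refl (p : ℕ) : Linked N ρ τ t p p := by
  intro x _ h1 h2
  simp at h1 h2
  omega

theorem Linked.trans (h : Linked N ρ τ t p q) (h' : Linked N ρ τ t q r) : Linked N ρ τ t p r := by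
  intro x hx h1 h2
  have a := h x hx
  have b := h' x hx
  omega

theorem Linked.mono (hst : s ≤ t) (h : Linked N ρ τ t p q) : Linked N ρ τ s p q :=
  fun x hx h1 h2 => lt_of_le_of_lt hst (h x hx h1 h2)

end Linked

section Certificate

variable {N : ℕ} {nb : ℕ → List ℕ} {ρ τ nx : ℕ → ℕ} {z : ℕ}

theorem SplitCertificate.ne_last (h : SplitCertificate N nb ρ τ nx z) {p q : ℕ} (hq : q < N)
    (hpq : ρ p < ρ q) : p ≠ z := by
  rintro rfl
  exact absurd (h.rank_le_last q hq) (by omega)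

theorem SplitCertificate.linked_zero (h : SplitCertificate N nb ρ τ nx z) {p q : ℕ} (hp : p < N)
    (hq : q < N) : Linked N ρ τ 0 p q := by
  intro x hx _ h2
  refine h.time_pos x hx ?_
  rcases lt_max_iff.1 h2 with h2 | h2
  · exact h.ne_last hp h2
  · exact h.ne_last hq h2

/-- A function that is constant along the consecutive pairs with a late cut identifies all nodes
that are not separated by early cuts. -/
theorem SplitCertificate.eq_of_linked (h : SplitCertificate N nb ρ τ nx z) {t : ℕ}
    {C : Type*} {g : ℕ → C} (hstep : ∀ p < N, p ≠ z → t < τ p → g p = g (nx p)) {p q : ℕ}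
    (hp : p < N) (hq : q < N) (hpq : Linked N ρ τ t p q) : g p = g q := by
  have key : ∀ d p q, p < N → q < N → ρ p ≤ ρ q → ρ q - ρ p ≤ d → Linked N ρ τ t p q →
      g p = g q := by
    intro d
    induction d with
    | zero =>
      intro p q hp hq h1 h2 _
      rw [h.rank_inj p hp q hq (by omega)]
    | succ d ih =>
      intro p q hp hq h1 h2 hl
      rcases h1.eq_or_lt with h1 | h1
      · rw [h.rank_inj p hp q hq h1]
      have hz := h.ne_last hq h1
      have hgt := h.lt_rank_next p hp hz
      have hle := h.rank_next_le p hp hz q hq h1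
      refine (hstep p hp hz (hl p hp (by omega) (by omega))).trans
        (ih _ q (h.next_lt p hp hz) hq hle (by omega) ?_)
      intro x hx h3 h4
      exact hl x hx (by omega) (by omega)
  rcases le_total (ρ p) (ρ q) with hle | hle
  · exact key _ p q hp hq hle le_rfl hpq
  · exact (key _ q p hq hp hle le_rfl hpq.symm).symm

theorem SplitCertificate.linked_next (h : SplitCertificate N nb ρ τ nx z) {t p : ℕ} (hp : p < N)
    (hz : p ≠ z) (ht : t < τ p) : Linked N ρ τ t p (nx p) := by
  have h1 := h.lt_rank_next p hp hz
  intro x hx h2 h3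
  have : x = p := by
    refine h.rank_inj x hx p hp ?_
    by_contra hne
    have := h.rank_next_le p hp hz x hx (by omega)
    omega
  rwa [this]

/-- The cut of time `t + 1` between two nodes that are linked up to time `t`. -/
theorem SplitCertificate.exists_cut (h : SplitCertificate N nb ρ τ nx z) {t p q : ℕ}
    (hq : q < N) (hle : ρ p ≤ ρ q) (hpq : Linked N ρ τ t p q) (hn : ¬ Linked N ρ τ (t + 1) p q) :
    ∃ x < N, x ≠ z ∧ τ x = t + 1 ∧ Linked N ρ τ (t + 1) p x ∧ Linked N ρ τ (t + 1) (nx x) q ∧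
      ρ p ≤ ρ x ∧ ρ x < ρ q := by
  simp only [Linked, not_forall] at hn
  obtain ⟨x, hx, h1, h2, h3⟩ := hn
  have hτ : τ x = t + 1 := by
    have := hpq x hx h1 h2
    omega
  have hxq : ρ x < ρ q := by omega
  have hxz := h.ne_last hq hxq
  have hgt := h.lt_rank_next x hx hxz
  have hnq := h.rank_next_le x hx hxz q hq hxq
  -- Earlier cuts are excluded by `hpq` and times are distinct, so `x` is the only cut of time at
  -- most `t + 1` between `p` and `q`.
  have huniq : ∀ y < N, ρ p ≤ ρ y → ρ y < ρ q → y ≠ x → t + 1 < τ y := by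
    intro y hy h4 h5 hne
    have h6 := hpq y hy (by omega) (by omega)
    have h7 : τ y ≠ τ x := fun he => hne (h.time_inj y hy (h.ne_last hq h5) x hx hxz he)
    omega
  refine ⟨x, hx, hxz, hτ, ?_, ?_, by omega, hxq⟩
  · intro y hy h4 h5
    refine huniq y hy (by omega) (by omega) ?_
    rintro rfl
    omega
  · intro y hy h4 h5
    refine huniq y hy (by omega) (by omega) ?_
    rintro rfl
    omega

/-- The `N - 1` cuts have distinct times in `[1, N)`, so by counting every time is used. Hence no
round before the last one is idle. -/
theorem SplitCertificate.exists_time (h : SplitCertificate N nb ρ τ nx z) {t : ℕ} (ht : 0 < t)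
    (htN : t < N) : ∃ x < N, x ≠ z ∧ τ x = t := by
  have hsub : ((Finset.range N).erase z).image τ ⊆ Finset.Ico 1 N := by
    intro y hy
    simp only [Finset.mem_image, Finset.mem_erase, Finset.mem_range] at hy
    obtain ⟨x, ⟨hxz, hx⟩, rfl⟩ := hy
    exact Finset.mem_Ico.2 ⟨h.time_pos x hx hxz, h.time_lt x hx hxz⟩
  have hcard : (((Finset.range N).erase z).image τ).card = N - 1 := by
    rw [Finset.card_image_of_injOn, Finset.card_erase_of_mem (Finset.mem_range.2 h.last_lt),
      Finset.card_range]
    intro x hx y hy hxy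
    simp only [Finset.coe_erase, Finset.coe_range, Set.mem_sdiff, Set.mem_Iio,
      Set.mem_singleton_iff] at hx hy
    exact h.time_inj x hx.1 hx.2 y hy.1 hy.2 hxy
  have heq := Finset.eq_of_subset_of_card_le hsub (by simp [hcard])
  have hmem : t ∈ ((Finset.range N).erase z).image τ := by
    rw [heq]
    exact Finset.mem_Ico.2 ⟨ht, htN⟩
  simp only [Finset.mem_image, Finset.mem_erase, Finset.mem_range] at hmem
  obtain ⟨x, ⟨hxz, hx⟩, hxt⟩ := hmem
  exact ⟨x, hx, hxz, hxt⟩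

variable {G : SimpleGraph (Fin N)} [DecidableRel G.Adj]

theorem map_colour_eq_of_rel {t : ℕ} {C : Type*} {f : Fin N → C}
    (hf : ∀ u v : Fin N, Linked N ρ τ t u v → f u = f v) {s s' : Multiset (Fin N)}
    (hs : Multiset.Rel (Linked N ρ τ t) (s.map Fin.val) (s'.map Fin.val)) :
    s.map f = s'.map f := by
  rw [Multiset.rel_map] at hs
  rw [← Multiset.rel_eq, Multiset.rel_map]
  exact hs.mono fun a _ b _ hab => hf a b hab

/-- A colour of round `t` determines on which side of the cut of time `t` a node lies, by `ih`. The
multiset of neighbour colours therefore determines the number of neighbours on the lower side, and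
`unmatched` makes these numbers differ. -/
theorem SplitCertificate.colour_succ_ne (h : SplitCertificate N nb ρ τ nx z)
    (hnb : ∀ v : Fin N, (G.neighborFinset v).val.map Fin.val = (nb v : Multiset ℕ)) {t : ℕ}
    (ih : ∀ u v : Fin N, colourRefinement G (fun _ => ()) t u =
      colourRefinement G (fun _ => ()) t v → Linked N ρ τ t u v)
    {u v : Fin N} (hz : (u : ℕ) ≠ z) (hv : (v : ℕ) = nx u) (ht : τ u = t + 1) :
    colourRefinement G (fun _ => ()) (t + 1) u ≠ colourRefinement G (fun _ => ()) (t + 1) v := by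
  intro heq
  have hmap : (G.neighborFinset u).val.map (colourRefinement G (fun _ => ()) t) =
      (G.neighborFinset v).val.map (colourRefinement G (fun _ => ()) t) := congrArg Prod.snd heq
  rcases h.unmatched u u.2 hz with ⟨_, hlen⟩ | ⟨x, hx, hxz, hxt, hcount⟩
  · apply hlen
    have h1 := congrArg Multiset.card (hnb u)
    have h2 := congrArg Multiset.card (hnb v)
    have h3 := congrArg Multiset.card hmap
    simp only [Multiset.card_map, Multiset.coe_card] at h1 h2 h3
    rw [← hv]
    omega
  · apply hcount
    classical
    let P : RefinedColour Unit t → Prop := fun c =>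
      ∃ w : Fin N, colourRefinement G (fun _ => ()) t w = c ∧ ρ w ≤ ρ x
    have hP : ∀ w : Fin N, P (colourRefinement G (fun _ => ()) t w) ↔ ρ w ≤ ρ x := by
      intro w
      refine ⟨?_, fun hw => ⟨w, rfl, hw⟩⟩
      rintro ⟨w', hw', hle⟩
      by_contra hlt
      have := ih w' w hw' x hx (by omega) (by omega)
      omega
    have hc : ∀ w : Fin N, (nb w).countP (fun y => decide (ρ y ≤ ρ x)) =
        ((G.neighborFinset w).val.map (colourRefinement G (fun _ => ()) t)).countP P := by
      intro w
      rw [← Multiset.coe_countP, ← hnb, Multiset.countP_map, Multiset.countP_map]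
      congr 1
      refine Multiset.filter_congr fun y _ => ?_
      rw [hP]
    rw [← hv, hc, hc, hmap]

/-- Induction on `t`. Linked nodes are joined by consecutive nodes with late cuts, and each such
step preserves the colour by `matched`. Conversely, equally coloured nodes that become unlinked in
round `t + 1` have a single new cut between them; its two sides would then be equally coloured,
against `colour_succ_ne`. -/
theorem SplitCertificate.colour_eq_iff (h : SplitCertificate N nb ρ τ nx z)
    (hnb : ∀ v : Fin N, (G.neighborFinset v).val.map Fin.val = (nb v : Multiset ℕ)) (t : ℕ) :
    ∀ u v : Fin N, colourRefinement G (fun _ => ()) t u = colourRefinement G (fun _ => ()) t v ↔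
      Linked N ρ τ t u v := by
  induction t with
  | zero => exact fun u v => ⟨fun _ => h.linked_zero u.2 v.2, fun _ => rfl⟩
  | succ t ih =>
    have hback : ∀ u v : Fin N, Linked N ρ τ (t + 1) u v →
        colourRefinement G (fun _ => ()) (t + 1) u =
          colourRefinement G (fun _ => ()) (t + 1) v := by
      intro u v huv
      -- The colouring is extended to all of `ℕ`, because `eq_of_linked` walks through natural
      -- numbers rather than elements of `Fin N`.
      let g : ℕ → Option (RefinedColour Unit (t + 1)) := fun p =>
        if hp : p < N then some (colourRefinement G (fun _ => ()) (t + 1) ⟨p, hp⟩) else none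
      have hg : g u = g v := by
        refine h.eq_of_linked (t := t + 1) ?_ u.2 v.2 huv
        intro p hp hz ht
        have hq := h.next_lt p hp hz
        simp only [g, dif_pos hp, dif_pos hq, Option.some.injEq]
        have ht' : t < τ p := by omega
        refine Prod.ext ((ih ⟨p, hp⟩ ⟨nx p, hq⟩).2 (h.linked_next hp hz ht')) ?_
        change (G.neighborFinset ⟨p, hp⟩).val.map (colourRefinement G (fun _ => ()) t) =
          (G.neighborFinset ⟨nx p, hq⟩).val.map (colourRefinement G (fun _ => ()) t)
        refine map_colour_eq_of_rel (t := t) (fun a b hab => (ih a b).2 hab) ?_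
        rw [hnb, hnb]
        exact (h.matched p hp hz (by omega)).mono fun a _ b _ hab => hab.mono (by omega)
      simpa [g] using hg
    have hforth : ∀ u v : Fin N, ρ u ≤ ρ v → colourRefinement G (fun _ => ()) (t + 1) u =
        colourRefinement G (fun _ => ()) (t + 1) v → Linked N ρ τ (t + 1) u v := by
      intro u v hle huv
      by_contra hn
      obtain ⟨x, hx, hxz, hτ, hux, hxv, _, _⟩ :=
        h.exists_cut v.2 hle ((ih u v).1 (congrArg Prod.fst huv)) hn
      have hnx := h.next_lt x hx hxz
      refine h.colour_succ_ne hnb (fun a b => (ih a b).1) (u := ⟨x, hx⟩) (v := ⟨nx x, hnx⟩) hxz rfl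
        hτ ?_
      rw [← hback u ⟨x, hx⟩ hux, huv, hback ⟨nx x, hnx⟩ v hxv]
    intro u v
    refine ⟨fun huv => ?_, hback u v⟩
    rcases le_total (ρ u) (ρ v) with hle | hle
    · exact hforth u v hle huv
    · exact (hforth v u hle huv.symm).symm

/-- A graph with a certificate is a long-refinement graph. -/
theorem SplitCertificate.isLongRefinement (h : SplitCertificate N nb ρ τ nx z)
    (hnb : ∀ v : Fin N, (G.neighborFinset v).val.map Fin.val = (nb v : Multiset ℕ)) :
    IsLongRefinement G := by
  have hN := h.last_lt
  have hlast : ∀ t, N - 1 ≤ t → ∀ u v : Fin N,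
      colourRefinement G (fun _ => ()) t u = colourRefinement G (fun _ => ()) t v ↔ u = v := by
    intro t ht u v
    refine ⟨fun huv => ?_, fun huv => by rw [huv]⟩
    have hl := (h.colour_eq_iff hnb t u v).1 huv
    have key : ∀ u v : Fin N, ρ u ≤ ρ v → Linked N ρ τ t u v → u = v := by
      intro u v hle hl
      rcases hle.eq_or_lt with he | hlt
      · exact Fin.ext (h.rank_inj u u.2 v v.2 he)
      · have h1 := hl u u.2 (by omega) (by omega)
        have h2 := h.time_lt u u.2 (h.ne_last v.2 hlt)
        omega
    rcases le_total (ρ u) (ρ v) with hle | hle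
    · exact key u v hle hl
    · exact (key v u hle hl.symm).symm
  have hiter : wlOne G = N - 1 := by
    unfold wlOne iterationNumber
    classical
    refine (Nat.find_eq_iff _).2 ⟨?_, ?_⟩
    · refine Setoid.ext fun u v => ?_
      exact (hlast (N - 1) le_rfl u v).trans (hlast (N - 1 + 1) (by omega) u v).symm
    -- The cut of time `j + 1` separates two nodes in round `j + 1` that were still together in
    -- round `j`.
    · intro j hj heq
      obtain ⟨x, hx, hxz, hxt⟩ := h.exists_time (t := j + 1) (by omega) (by omega)
      have hnx := h.next_lt x hx hxz
      have hjx : j < τ x := by omega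
      have h1 : colourPartition G (fun _ => ()) j ⟨x, hx⟩ ⟨nx x, hnx⟩ :=
        (h.colour_eq_iff hnb j ⟨x, hx⟩ ⟨nx x, hnx⟩).2 (h.linked_next hx hxz hjx)
      rw [heq] at h1
      have h2 := (h.colour_eq_iff hnb (j + 1) ⟨x, hx⟩ ⟨nx x, hnx⟩).1 h1 x hx
      have h3 := h.lt_rank_next x hx hxz
      simp only at h2
      omega
  unfold IsLongRefinement
  rw [hiter, Fintype.card_fin]
  omega

end Certificate

/-! ### Strings of pairs and their graphs -/

/-- A string of `len` pairs of vertices. Consecutive pairs are joined by a matching; the pairs `p`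
with `loop p` span an edge; the two vertices of the pair `0` are adjacent to both vertices of the
pair `x₁` and to both vertices of the pair `x₂`, respectively. If `single = 1`, there is a further
vertex, adjacent to both vertices of the pair `anchor`. -/
structure PairString where
  len : ℕ
  single : ℕ
  x₁ : ℕ
  x₂ : ℕ
  anchor : ℕ
  loop : ℕ → Prop
  decLoop : DecidablePred loop

namespace PairString

attribute [instance] PairString.decLoop

/-- The parameters of the string describe a simple graph. -/
structure Valid (D : PairString) : Prop where
  single_le : D.single ≤ 1
  two_le_x₁ : 2 ≤ D.x₁
  two_le_x₂ : 2 ≤ D.x₂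
  x₁_lt : D.x₁ < D.len
  x₂_lt : D.x₂ < D.len
  x₁_ne_x₂ : D.x₁ ≠ D.x₂
  anchor_pos : 0 < D.anchor
  anchor_lt : D.anchor < D.len

/-- The neighbours in the quotient by the pairs, as long as the pairs `x₁` and `x₂` are not
distinguished; the node `len` is the single vertex. -/
def pairNb (D : PairString) (p : ℕ) : List ℕ :=
  if p = D.len then [D.anchor, D.anchor]
  else if p = 0 then [1, D.x₁, D.x₁]
  else (p - 1) :: ((if p + 1 < D.len then [p + 1] else []) ++ ((if D.loop p then [p] else []) ++
    ((if p = D.x₁ then [0] else []) ++ ((if p = D.x₂ then [0] else []) ++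
    (if D.single = 1 ∧ p = D.anchor then [D.len] else [])))))

/-- The neighbours in the graph: the pair `p` consists of `2 * p` and `2 * p + 1`, and the single
vertex is `2 * len`. -/
def vertexNb (D : PairString) (a : ℕ) : List ℕ :=
  if a = 2 * D.len then [2 * D.anchor, 2 * D.anchor + 1]
  else if a = 0 then [2, 2 * D.x₁, 2 * D.x₁ + 1]
  else if a = 1 then [3, 2 * D.x₂, 2 * D.x₂ + 1]
  else (a - 2) :: ((if a + 2 < 2 * D.len then [a + 2] else []) ++
    ((if D.loop (a / 2) then [4 * (a / 2) + 1 - a] else []) ++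
    ((if a / 2 = D.x₁ then [0] else []) ++ ((if a / 2 = D.x₂ then [1] else []) ++
    (if D.single = 1 ∧ a / 2 = D.anchor then [2 * D.len] else [])))))

/-- One disjunct for each kind of edge and direction. In this form, symmetry and irreflexivity of
adjacency become arithmetic. -/
theorem mem_vertexNb {D : PairString} (hD : D.Valid) {a b : ℕ} (ha : a < 2 * D.len + D.single) :
    b ∈ D.vertexNb a ↔
      (a < 2 * D.len ∧ b < 2 * D.len ∧ (a + 2 = b ∨ b + 2 = a)) ∨
      ((2 ≤ a ∧ a < 2 * D.len ∧ a / 2 = b / 2 ∧ a ≠ b) ∧ D.loop (a / 2)) ∨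
      (a = 0 ∧ b / 2 = D.x₁) ∨ (b = 0 ∧ a / 2 = D.x₁) ∨
      (a = 1 ∧ b / 2 = D.x₂) ∨ (b = 1 ∧ a / 2 = D.x₂) ∨
      (D.single = 1 ∧ a = 2 * D.len ∧ b / 2 = D.anchor) ∨
      (D.single = 1 ∧ b = 2 * D.len ∧ a / 2 = D.anchor) := by
  obtain ⟨h1, h2, h3, h4, h5, h6, h7, h8⟩ := hD
  unfold vertexNb
  by_cases c1 : a = 2 * D.len
  · rw [if_pos c1]
    simp only [List.mem_cons, List.not_mem_nil, or_false]
    constructor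
    · intro h
      exact Or.inr (Or.inr (Or.inr (Or.inr (Or.inr (Or.inr (Or.inl (by omega)))))))
    · rintro (h | ⟨h, _⟩ | h | h | h | h | h | h) <;> omega
  by_cases c2 : a = 0
  · rw [if_neg c1, if_pos c2]
    simp only [List.mem_cons, List.not_mem_nil, or_false]
    constructor
    · rintro (h | h)
      · exact Or.inl (by omega)
      · exact Or.inr (Or.inr (Or.inl (by omega)))
    · rintro (h | ⟨h, _⟩ | h | h | h | h | h | h) <;> omega
  by_cases c3 : a = 1
  · rw [if_neg c1, if_neg c2, if_pos c3]
    simp only [List.mem_cons, List.not_mem_nil, or_false]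
    constructor
    · rintro (h | h)
      · exact Or.inl (by omega)
      · exact Or.inr (Or.inr (Or.inr (Or.inr (Or.inl (by omega)))))
    · rintro (h | ⟨h, _⟩ | h | h | h | h | h | h) <;> omega
  · rw [if_neg c1, if_neg c2, if_neg c3]
    simp only [List.mem_cons, List.mem_append, List.mem_ite_nil_right, List.not_mem_nil, or_false]
    constructor
    · rintro (h | h | h | h | h | h)
      · exact Or.inl (by omega)
      · exact Or.inl (by omega)
      · exact Or.inr (Or.inl ⟨by omega, h.1⟩)
      · exact Or.inr (Or.inr (Or.inr (Or.inl (by omega))))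
      · exact Or.inr (Or.inr (Or.inr (Or.inr (Or.inr (Or.inl (by omega))))))
      · exact Or.inr (Or.inr (Or.inr (Or.inr (Or.inr (Or.inr (Or.inr (by omega)))))))
    · rintro (h | h | h | h | h | h | h | h)
      · rcases h.2.2 with h' | h'
        · exact Or.inr (Or.inl (by omega))
        · exact Or.inl (by omega)
      · exact Or.inr (Or.inr (Or.inl ⟨h.2, by omega⟩))
      · omega
      · exact Or.inr (Or.inr (Or.inr (Or.inl (by omega))))
      · omega
      · exact Or.inr (Or.inr (Or.inr (Or.inr (Or.inl (by omega)))))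
      · omega
      · exact Or.inr (Or.inr (Or.inr (Or.inr (Or.inr (by omega)))))

theorem nodup_vertexNb {D : PairString} (hD : D.Valid) {a : ℕ} (ha : a < 2 * D.len + D.single) :
    (D.vertexNb a).Nodup := by
  obtain ⟨h1, h2, h3, h4, h5, h6, h7, h8⟩ := hD
  unfold vertexNb
  split_ifs <;> simp <;> omega

theorem vertexNb_lt {D : PairString} (hD : D.Valid) {a b : ℕ} (ha : a < 2 * D.len + D.single)
    (hb : b ∈ D.vertexNb a) : b < 2 * D.len + D.single := by
  rw [mem_vertexNb hD ha] at hb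
  obtain ⟨h1, h2, h3, h4, h5, h6, h7, h8⟩ := hD
  omega

/-- The graph described by a string of pairs. -/
def graph (D : PairString) (hD : D.Valid) : SimpleGraph (Fin (2 * D.len + D.single)) where
  Adj a b := (b : ℕ) ∈ D.vertexNb a
  symm := ⟨by
    intro a b hab
    have ha := a.2
    have hb := b.2
    rw [mem_vertexNb hD ha] at hab
    rw [mem_vertexNb hD hb]
    obtain ⟨h1, h2, h3, h4, h5, h6, h7, h8⟩ := hD
    rcases hab with hab | ⟨⟨k1, k2, k3, k4⟩, hl⟩ | hab
    · left
      omega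
    · right
      left
      rw [← k3]
      exact ⟨by omega, hl⟩
    · right
      right
      omega⟩
  loopless := ⟨by
    intro a hab
    have ha := a.2
    rw [mem_vertexNb hD ha] at hab
    obtain ⟨h1, h2, h3, h4, h5, h6, h7, h8⟩ := hD
    omega⟩

instance (D : PairString) (hD : D.Valid) : DecidableRel (D.graph hD).Adj :=
  fun a b => inferInstanceAs (Decidable ((b : ℕ) ∈ D.vertexNb a))

theorem neighborFinset_graph {D : PairString} (hD : D.Valid)
    (v : Fin (2 * D.len + D.single)) :
    ((D.graph hD).neighborFinset v).val.map Fin.val = (D.vertexNb v : Multiset ℕ) := by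
  refine (Multiset.Nodup.ext ?_ ?_).2 ?_
  · exact (Finset.nodup _).map Fin.val_injective
  · exact Multiset.coe_nodup.2 (nodup_vertexNb hD v.2)
  · intro b
    simp only [Multiset.mem_map, Finset.mem_val, SimpleGraph.mem_neighborFinset, Multiset.mem_coe]
    constructor
    · rintro ⟨w, hw, rfl⟩
      exact hw
    · intro hb
      exact ⟨⟨b, vertexNb_lt hD v.2 hb⟩, hb, rfl⟩

/-- Halving is the quotient map. It respects neighbour lists except at the vertex `1`, which sees
`x₂` where the quotient node `0` sees `x₁`. -/
theorem map_vertexNb {D : PairString} (hD : D.Valid) {a : ℕ} (ha : a < 2 * D.len + D.single)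
    (ha1 : a ≠ 1) : (D.vertexNb a).map (· / 2) = D.pairNb (a / 2) := by
  obtain ⟨h1, h2, h3, h4, h5, h6, h7, h8⟩ := hD
  unfold vertexNb pairNb
  by_cases c1 : a = 2 * D.len
  · have c1' : a / 2 = D.len := by omega
    rw [if_pos c1, if_pos c1']
    simp
    omega
  by_cases c2 : a = 0
  · have c1' : a / 2 ≠ D.len := by omega
    have c2' : a / 2 = 0 := by omega
    rw [if_neg c1, if_pos c2, if_neg c1', if_pos c2']
    simp
    omega
  have c1' : a / 2 ≠ D.len := by omega
  have c2' : a / 2 ≠ 0 := by omega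
  rw [if_neg c1, if_neg c2, if_neg ha1, if_neg c1', if_neg c2']
  have e1 : (a - 2) / 2 = a / 2 - 1 := by omega
  have e2 : (a + 2) / 2 = a / 2 + 1 := by omega
  have e3 : (4 * (a / 2) + 1 - a) / 2 = a / 2 := by omega
  have e4 : (a + 2 < 2 * D.len) = (a / 2 + 1 < D.len) := by
    apply propext
    omega
  have e5 : (2 * D.len) / 2 = D.len := by omega
  simp only [List.map_cons, List.map_append, apply_ite (List.map (· / 2)), List.map_nil, e1, e2, e3,
    e4, e5, show 1 / 2 = 0 from rfl]

theorem length_vertexNb {D : PairString} (hD : D.Valid) {a : ℕ}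
    (ha : a < 2 * D.len + D.single) : (D.vertexNb a).length = (D.pairNb (a / 2)).length := by
  by_cases ha1 : a = 1
  · have := hD.x₁_lt
    subst ha1
    unfold vertexNb pairNb
    rw [if_neg (by omega), if_neg (by omega), if_pos rfl, if_neg (by omega), if_pos (by omega)]
    rfl
  · rw [← map_vertexNb hD ha ha1, List.length_map]

theorem degree_graph {D : PairString} (hD : D.Valid) (v : Fin (2 * D.len + D.single)) :
    (D.graph hD).degree v = (D.pairNb (v / 2)).length := by
  rw [← length_vertexNb hD v.2, ← Multiset.coe_card, ← neighborFinset_graph hD, Multiset.card_map]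
  rfl

/-! ### Lifting a certificate from the quotient to the graph -/

/-- Ranks of the vertices: the vertices of a pair are consecutive. -/
def vertexRank (ρ : ℕ → ℕ) (a : ℕ) : ℕ := 2 * ρ (a / 2) + a % 2

/-- Times of the cuts: the pairs are split last, in the order of the string. -/
def vertexTime (D : PairString) (τ : ℕ → ℕ) (a : ℕ) : ℕ :=
  -- The single vertex `2 * len` is even but forms a node of its own, so the cut after it is a cut
  -- of the quotient; hence the second condition.
  if a % 2 = 0 ∧ a < 2 * D.len then D.len + D.single + a / 2 else τ (a / 2)

/-- Successors of the vertices with respect to the rank. -/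
def vertexNext (D : PairString) (nx : ℕ → ℕ) (a : ℕ) : ℕ :=
  if a % 2 = 0 ∧ a < 2 * D.len then a + 1 else 2 * nx (a / 2)

section Lift

variable {D : PairString} {ρ τ nx : ℕ → ℕ} {z : ℕ}

theorem vertexTime_even {a : ℕ} (h : a % 2 = 0 ∧ a < 2 * D.len) :
    D.vertexTime τ a = D.len + D.single + a / 2 := if_pos h

theorem vertexTime_odd {a : ℕ} (h : ¬ (a % 2 = 0 ∧ a < 2 * D.len)) :
    D.vertexTime τ a = τ (a / 2) := if_neg h

theorem vertexNext_even {a : ℕ} (h : a % 2 = 0 ∧ a < 2 * D.len) :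
    D.vertexNext nx a = a + 1 := if_pos h

theorem vertexNext_odd {a : ℕ} (h : ¬ (a % 2 = 0 ∧ a < 2 * D.len)) :
    D.vertexNext nx a = 2 * nx (a / 2) := if_neg h

/-- Cuts inside pairs have time at least `len + single`, so before that time only the cuts of the
quotient matter. -/
theorem linked_vertex (hD : D.Valid)
    (h : SplitCertificate (D.len + D.single) D.pairNb ρ τ nx z) {t a b : ℕ}
    (ht : t < D.len + D.single) (ha : a < 2 * D.len + D.single) (hb : b < 2 * D.len + D.single)
    (hab : Linked (D.len + D.single) ρ τ t (a / 2) (b / 2)) :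
    Linked (2 * D.len + D.single) (vertexRank ρ) (D.vertexTime τ) t a b := by
  have hs := hD.single_le
  intro x hx h1 h2
  by_cases hx2 : x % 2 = 0 ∧ x < 2 * D.len
  · rw [vertexTime_even hx2]
    omega
  · rw [vertexTime_odd hx2]
    unfold vertexRank at h1 h2
    refine hab (x / 2) (by omega) (by omega) ?_
    have ia := h.rank_inj (x / 2) (by omega) (a / 2) (by omega)
    have ib := h.rank_inj (x / 2) (by omega) (b / 2) (by omega)
    omega

theorem rel_map_half (hD : D.Valid)
    (h : SplitCertificate (D.len + D.single) D.pairNb ρ τ nx z) {t : ℕ}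
    (ht : t < D.len + D.single) {L L' : List ℕ} (hL : ∀ a ∈ L, a < 2 * D.len + D.single)
    (hL' : ∀ a ∈ L', a < 2 * D.len + D.single)
    (hr : Multiset.Rel (Linked (D.len + D.single) ρ τ t) (L.map (· / 2) : Multiset ℕ)
      (L'.map (· / 2) : Multiset ℕ)) :
    Multiset.Rel (Linked (2 * D.len + D.single) (vertexRank ρ) (D.vertexTime τ) t)
      (L : Multiset ℕ) (L' : Multiset ℕ) := by
  rw [← Multiset.map_coe, ← Multiset.map_coe, Multiset.rel_map] at hr
  exact hr.mono fun a ha b hb hab => linked_vertex hD h ht (hL a ha) (hL' b hb) hab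

theorem rel_coe_cons {R : ℕ → ℕ → Prop} {a b : ℕ} {L L' : List ℕ} (hab : R a b)
    (h : Multiset.Rel R (L : Multiset ℕ) (L' : Multiset ℕ)) :
    Multiset.Rel R ((a :: L : List ℕ) : Multiset ℕ) ((b :: L' : List ℕ) : Multiset ℕ) :=
  Multiset.Rel.cons hab h

theorem rel_coe_append {R : ℕ → ℕ → Prop} {K K' L L' : List ℕ}
    (hK : Multiset.Rel R (K : Multiset ℕ) (K' : Multiset ℕ))
    (h : Multiset.Rel R (L : Multiset ℕ) (L' : Multiset ℕ)) :
    Multiset.Rel R ((K ++ L : List ℕ) : Multiset ℕ) ((K' ++ L' : List ℕ) : Multiset ℕ) := by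
  rw [← Multiset.coe_add, ← Multiset.coe_add]
  exact Multiset.Rel.add hK h

theorem rel_coe_ite {R : ℕ → ℕ → Prop} {c : Prop} [Decidable c] {a b : ℕ} (hab : c → R a b) :
    Multiset.Rel R ((if c then [a] else [] : List ℕ) : Multiset ℕ)
      ((if c then [b] else [] : List ℕ) : Multiset ℕ) := by
  split_ifs with hc
  · exact rel_coe_cons (hab hc) Multiset.Rel.zero
  · exact Multiset.Rel.zero

/-- The halved neighbours of a vertex in the quotient; the vertex `1` is exceptional. -/
theorem rel_map_vertexNb (hD : D.Valid) {t : ℕ} (hX : Linked (D.len + D.single) ρ τ t D.x₁ D.x₂)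
    {a : ℕ} (ha : a < 2 * D.len + D.single) :
    Multiset.Rel (Linked (D.len + D.single) ρ τ t) ((D.vertexNb a).map (· / 2) : Multiset ℕ)
      (D.pairNb (a / 2) : Multiset ℕ) := by
  by_cases h1 : a = 1
  · subst h1
    have := hD.x₁_lt
    have hv : (D.vertexNb 1).map (· / 2) = [1, D.x₂, D.x₂] := by
      unfold vertexNb
      rw [if_neg (by omega), if_neg (by omega), if_pos rfl]
      simp
      omega
    have hp : D.pairNb (1 / 2) = [1, D.x₁, D.x₁] := by
      unfold pairNb
      rw [if_neg (by omega), if_pos (by omega)]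
    rw [hv, hp]
    exact rel_coe_cons (Linked.refl _) (rel_coe_cons hX.symm (rel_coe_cons hX.symm
      Multiset.Rel.zero))
  · rw [map_vertexNb hD ha h1]
    exact Multiset.rel_refl_of_refl_on fun x _ => Linked.refl x

theorem countP_map_vertexNb (hD : D.Valid) {a : ℕ} (ha : a < 2 * D.len + D.single) {P : ℕ → Bool}
    (hX : P D.x₁ = P D.x₂) :
    ((D.vertexNb a).map (· / 2)).countP P = (D.pairNb (a / 2)).countP P := by
  by_cases h1 : a = 1
  · subst h1
    have := hD.x₁_lt
    have hv : (D.vertexNb 1).map (· / 2) = [1, D.x₂, D.x₂] := by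
      unfold vertexNb
      rw [if_neg (by omega), if_neg (by omega), if_pos rfl]
      simp
      omega
    have hp : D.pairNb (1 / 2) = [1, D.x₁, D.x₁] := by
      unfold pairNb
      rw [if_neg (by omega), if_pos (by omega)]
    rw [hv, hp]
    simp only [List.countP_cons, hX]
  · rw [map_vertexNb hD ha h1]

theorem vertexNb_zero (hD : D.Valid) : D.vertexNb 0 = [2, 2 * D.x₁, 2 * D.x₁ + 1] := by
  have := hD.x₁_lt
  unfold vertexNb
  rw [if_neg (by omega), if_pos rfl]

theorem vertexNb_one (hD : D.Valid) : D.vertexNb 1 = [3, 2 * D.x₂, 2 * D.x₂ + 1] := by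
  have := hD.x₁_lt
  unfold vertexNb
  rw [if_neg (by omega), if_neg (by omega), if_pos rfl]

theorem vertexNb_even {p : ℕ} (hp : 0 < p) (hpl : p < D.len) :
    D.vertexNb (2 * p) = (2 * p - 2) :: ((if p + 1 < D.len then [2 * p + 2] else []) ++
      ((if D.loop p then [2 * p + 1] else []) ++
      ((if p = D.x₁ then [0] else []) ++ ((if p = D.x₂ then [1] else []) ++
      (if D.single = 1 ∧ p = D.anchor then [2 * D.len] else []))))) := by
  have e : (2 * p + 2 < 2 * D.len) = (p + 1 < D.len) := by
    apply propext
    omega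
  have e2 : 2 * p / 2 = p := by omega
  have e3 : 4 * p + 1 - 2 * p = 2 * p + 1 := by omega
  have c1 : 2 * p ≠ 2 * D.len := by omega
  have c2 : 2 * p ≠ 0 := by omega
  have c3 : 2 * p ≠ 1 := by omega
  unfold vertexNb
  rw [if_neg c1, if_neg c2, if_neg c3]
  simp only [e, e2, e3]

theorem vertexNb_odd {p : ℕ} (hp : 0 < p) (hpl : p < D.len) :
    D.vertexNb (2 * p + 1) = (2 * p - 1) :: ((if p + 1 < D.len then [2 * p + 3] else []) ++
      ((if D.loop p then [2 * p] else []) ++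
      ((if p = D.x₁ then [0] else []) ++ ((if p = D.x₂ then [1] else []) ++
      (if D.single = 1 ∧ p = D.anchor then [2 * D.len] else []))))) := by
  have e : (2 * p + 1 + 2 < 2 * D.len) = (p + 1 < D.len) := by
    apply propext
    omega
  have e2 : (2 * p + 1) / 2 = p := by omega
  have e3 : 4 * p + 1 - (2 * p + 1) = 2 * p := by omega
  have e4 : 2 * p + 1 - 2 = 2 * p - 1 := by omega
  have c1 : 2 * p + 1 ≠ 2 * D.len := by omega
  have c2 : 2 * p + 1 ≠ 0 := by omega
  have c3 : 2 * p + 1 ≠ 1 := by omega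
  unfold vertexNb
  rw [if_neg c1, if_neg c2, if_neg c3]
  simp only [e, e2, e3, e4]

/-- The two vertices of a pair are linked until the time of its cut. -/
theorem linked_pair (hD : D.Valid)
    (h : SplitCertificate (D.len + D.single) D.pairNb ρ τ nx z) {t p : ℕ} (hp : p < D.len)
    (ht : t < D.len + D.single + p) :
    Linked (2 * D.len + D.single) (vertexRank ρ) (D.vertexTime τ) t (2 * p) (2 * p + 1) := by
  have hs := hD.single_le
  intro x hx h1 h2
  unfold vertexRank at h1 h2
  have e1 : 2 * p / 2 = p := by omega
  have e2 : (2 * p + 1) / 2 = p := by omega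
  rw [e1, e2] at h1 h2
  have hxp : x / 2 = p := h.rank_inj (x / 2) (by omega) p (by omega) (by omega)
  have hx0 : x % 2 = 0 := by
    rw [hxp] at h1 h2
    omega
  rw [vertexTime_even (by omega)]
  omega

/-- The neighbours of the two vertices of a pair `p > 0` are either common or the two halves of one
of the pairs `p - 1`, `p`, `p + 1`, none of which is split by the time in question. For `p = 0` the
pairs `x₁` and `x₂` take part, and `hX` matches them. -/
theorem matched_pair (hD : D.Valid)
    (h : SplitCertificate (D.len + D.single) D.pairNb ρ τ nx z)
    (hX : Linked (D.len + D.single) ρ τ (D.len + D.single - 2) D.x₁ D.x₂) {p : ℕ}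
    (hp : p < D.len) :
    Multiset.Rel (Linked (2 * D.len + D.single) (vertexRank ρ) (D.vertexTime τ)
      (D.len + D.single + p - 2)) (D.vertexNb (2 * p) : Multiset ℕ)
      (D.vertexNb (2 * p + 1) : Multiset ℕ) := by
  obtain ⟨h1, h2, h3, h4, h5, h6, h7, h8⟩ := id hD
  rcases Nat.eq_zero_or_pos p with rfl | hp0
  · rw [vertexNb_zero hD, vertexNb_one hD]
    refine rel_coe_cons (linked_pair hD h (p := 1) (by omega) (by omega)) (rel_coe_cons ?_
      (rel_coe_cons ?_ Multiset.Rel.zero))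
    · refine linked_vertex hD h (by omega) (by omega) (by omega) ?_
      rwa [show 2 * D.x₁ / 2 = D.x₁ by omega, show 2 * D.x₂ / 2 = D.x₂ by omega]
    · refine linked_vertex hD h (by omega) (by omega) (by omega) ?_
      rwa [show (2 * D.x₁ + 1) / 2 = D.x₁ by omega, show (2 * D.x₂ + 1) / 2 = D.x₂ by omega]
  · rw [vertexNb_even hp0 hp, vertexNb_odd hp0 hp]
    refine rel_coe_cons ?_ (rel_coe_append (rel_coe_ite fun hc => ?_) (rel_coe_append
      (rel_coe_ite fun _ => ?_) (rel_coe_append (rel_coe_ite fun _ => Linked.refl _)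
      (rel_coe_append (rel_coe_ite fun _ => Linked.refl _) (rel_coe_ite fun _ => Linked.refl _)))))
    · have := linked_pair hD h (t := D.len + D.single + p - 2) (p := p - 1) (by omega) (by omega)
      rwa [show 2 * (p - 1) = 2 * p - 2 by omega, show 2 * p - 2 + 1 = 2 * p - 1 by omega] at this
    · exact linked_pair hD h (p := p + 1) (by omega) (by omega)
    · exact (linked_pair hD h (p := p) (by omega) (by omega)).symm

theorem countP_ite (P : ℕ → Bool) (c : Prop) [Decidable c] (a : ℕ) :
    (if c then [a] else [] : List ℕ).countP P = if c ∧ P a = true then 1 else 0 := by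
  by_cases hc : c <;> simp [hc, List.countP_cons]

end Lift

section Lift

variable {D : PairString} {ρ τ nx : ℕ → ℕ} {z : ℕ}

/-- The vertex whose cut corresponds to the cut after the node `x` of the quotient. -/
theorem exists_vertex_cut (hD : D.Valid)
    (h : SplitCertificate (D.len + D.single) D.pairNb ρ τ nx z) {x : ℕ}
    (hx : x < D.len + D.single) :
    ∃ y < 2 * D.len + D.single, y / 2 = x ∧ D.vertexTime τ y = τ x ∧
      ∀ w < 2 * D.len + D.single, (vertexRank ρ w ≤ vertexRank ρ y ↔ ρ (w / 2) ≤ ρ x) := by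
  have hs := hD.single_le
  by_cases hxl : x < D.len
  · refine ⟨2 * x + 1, by omega, by omega, ?_, ?_⟩
    · rw [vertexTime_odd (by omega), show (2 * x + 1) / 2 = x by omega]
    · intro w hw
      unfold vertexRank
      rw [show (2 * x + 1) / 2 = x by omega]
      omega
  · refine ⟨2 * x, by omega, by omega, ?_, ?_⟩
    · rw [vertexTime_odd (by omega), show 2 * x / 2 = x by omega]
    · intro w hw
      unfold vertexRank
      rw [show 2 * x / 2 = x by omega]
      have := h.rank_inj (w / 2) (by omega) x hx
      omega

/-- By `hX` only the last cut of the quotient can separate `x₁` from `x₂`, and some cut must. It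
puts two neighbours of the vertex `0` and two neighbours of the vertex `1` on opposite sides, which
starts the splitting of the pairs. -/
theorem unmatched_zero (hD : D.Valid)
    (h : SplitCertificate (D.len + D.single) D.pairNb ρ τ nx z)
    (hX : Linked (D.len + D.single) ρ τ (D.len + D.single - 2) D.x₁ D.x₂) :
    ∃ x < 2 * D.len + D.single, x / 2 ≠ z ∧ D.vertexTime τ x + 1 = D.len + D.single ∧
      (D.vertexNb 0).countP (fun w => decide (vertexRank ρ w ≤ vertexRank ρ x)) ≠
        (D.vertexNb 1).countP (fun w => decide (vertexRank ρ w ≤ vertexRank ρ x)) := by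
  obtain ⟨h1, h2, h3, h4, h5, h6, h7, h8⟩ := id hD
  have hcut : ∃ x < D.len + D.single, x ≠ z ∧ τ x + 1 = D.len + D.single ∧
      ((ρ D.x₁ ≤ ρ x ∧ ρ x < ρ D.x₂) ∨ (ρ D.x₂ ≤ ρ x ∧ ρ x < ρ D.x₁)) := by
    have hn : ∀ p q, p < D.len + D.single → q < D.len + D.single → ρ p < ρ q →
        ¬ Linked (D.len + D.single) ρ τ (D.len + D.single - 2 + 1) p q := by
      intro p q hp hq hlt hl
      have a := hl p hp (by omega) (by omega)
      have b := h.time_lt p hp (h.ne_last hq hlt)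
      omega
    rcases lt_trichotomy (ρ D.x₁) (ρ D.x₂) with hlt | heq | hlt
    · obtain ⟨x, hx, hxz, hτ, _, _, a, b⟩ := h.exists_cut (q := D.x₂) (by omega) hlt.le hX
        (hn _ _ (by omega) (by omega) hlt)
      exact ⟨x, hx, hxz, by omega, Or.inl ⟨a, b⟩⟩
    · exact absurd (h.rank_inj _ (by omega) _ (by omega) heq) h6
    · obtain ⟨x, hx, hxz, hτ, _, _, a, b⟩ := h.exists_cut (q := D.x₁) (by omega) hlt.le hX.symm
        (hn _ _ (by omega) (by omega) hlt)
      exact ⟨x, hx, hxz, by omega, Or.inr ⟨a, b⟩⟩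
  obtain ⟨x, hx, hxz, hτ, hsep⟩ := hcut
  obtain ⟨y, hy, hyx, hyt, hyr⟩ := exists_vertex_cut hD h hx
  refine ⟨y, hy, by omega, by omega, ?_⟩
  rw [vertexNb_zero hD, vertexNb_one hD]
  have e1 : 2 * D.x₁ / 2 = D.x₁ := by omega
  have e2 : (2 * D.x₁ + 1) / 2 = D.x₁ := by omega
  have e3 : 2 * D.x₂ / 2 = D.x₂ := by omega
  have e4 : (2 * D.x₂ + 1) / 2 = D.x₂ := by omega
  have r1 := hyr (2 * D.x₁) (by omega)
  have r2 := hyr (2 * D.x₁ + 1) (by omega)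
  have r3 := hyr (2 * D.x₂) (by omega)
  have r4 := hyr (2 * D.x₂ + 1) (by omega)
  rw [e1] at r1
  rw [e2] at r2
  rw [e3] at r3
  rw [e4] at r4
  simp only [List.countP_cons, List.countP_nil, decide_eq_true_eq, r1, r2, r3, r4]
  split_ifs <;> omega

/-- The previous cut runs through the pair `p - 1`, between the neighbours `2 * p - 2` and `2 * p -
1`. All other neighbours are common or have their counterpart on the same side. -/
theorem unmatched_pos
    (h : SplitCertificate (D.len + D.single) D.pairNb ρ τ nx z) {p : ℕ} (hp : 0 < p)
    (hpl : p < D.len) :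
    (D.vertexNb (2 * p)).countP
        (fun w => decide (vertexRank ρ w ≤ vertexRank ρ (2 * (p - 1)))) ≠
      (D.vertexNb (2 * p + 1)).countP
        (fun w => decide (vertexRank ρ w ≤ vertexRank ρ (2 * (p - 1)))) := by
  have i1 := h.rank_inj p (by omega) (p - 1) (by omega)
  have hθ : vertexRank ρ (2 * (p - 1)) = 2 * ρ (p - 1) := by
    unfold vertexRank
    rw [show 2 * (p - 1) / 2 = p - 1 by omega]
    omega
  have r1 : vertexRank ρ (2 * p - 2) = 2 * ρ (p - 1) := by
    rw [← hθ]
    congr 1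
    omega
  have r2 : vertexRank ρ (2 * p - 1) = 2 * ρ (p - 1) + 1 := by
    unfold vertexRank
    rw [show (2 * p - 1) / 2 = p - 1 by omega]
    omega
  have r3 : vertexRank ρ (2 * p) ≤ 2 * ρ (p - 1) ↔ vertexRank ρ (2 * p + 1) ≤ 2 * ρ (p - 1) := by
    unfold vertexRank
    rw [show 2 * p / 2 = p by omega, show (2 * p + 1) / 2 = p by omega]
    omega
  have r4 : p + 1 < D.len → (vertexRank ρ (2 * p + 2) ≤ 2 * ρ (p - 1) ↔
      vertexRank ρ (2 * p + 3) ≤ 2 * ρ (p - 1)) := by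
    intro hlt
    have i2 := h.rank_inj (p + 1) (by omega) (p - 1) (by omega)
    unfold vertexRank
    rw [show (2 * p + 2) / 2 = p + 1 by omega, show (2 * p + 3) / 2 = p + 1 by omega]
    omega
  have e4 : (p + 1 < D.len ∧ vertexRank ρ (2 * p + 2) ≤ 2 * ρ (p - 1)) =
      (p + 1 < D.len ∧ vertexRank ρ (2 * p + 3) ≤ 2 * ρ (p - 1)) :=
    propext (and_congr_right r4)
  rw [vertexNb_even hp hpl, vertexNb_odd hp hpl, hθ]
  have hn : ¬ 2 * ρ (p - 1) + 1 ≤ 2 * ρ (p - 1) := by omega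
  simp only [List.countP_cons, List.countP_append, countP_ite, decide_eq_true_eq, r1, r2, r3, e4,
    hn, le_refl, if_true, if_false]
  omega

/-- A certificate for the quotient gives a certificate for the graph. -/
theorem lift_certificate (hD : D.Valid)
    (h : SplitCertificate (D.len + D.single) D.pairNb ρ τ nx z) (hz : z < D.len)
    (hX : Linked (D.len + D.single) ρ τ (D.len + D.single - 2) D.x₁ D.x₂) :
    SplitCertificate (2 * D.len + D.single) D.vertexNb (vertexRank ρ) (D.vertexTime τ)
      (D.vertexNext nx) (2 * z + 1) := by
  have hs := hD.single_le
  have hl := hD.x₁_lt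
  have hodd : ∀ p, p < 2 * D.len + D.single → p ≠ 2 * z + 1 → ¬ (p % 2 = 0 ∧ p < 2 * D.len) →
      p / 2 < D.len + D.single ∧ p / 2 ≠ z := by
    intro p hp hpz hc
    omega
  constructor
  case last_lt => omega
  case rank_inj =>
    intro p hp q hq hpq
    unfold vertexRank at hpq
    have := h.rank_inj (p / 2) (by omega) (q / 2) (by omega) (by omega)
    omega
  case rank_le_last =>
    intro p hp
    have := h.rank_le_last (p / 2) (by omega)
    unfold vertexRank
    rw [show (2 * z + 1) / 2 = z by omega]
    omega
  case next_lt =>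
    intro p hp hpz
    by_cases hc : p % 2 = 0 ∧ p < 2 * D.len
    · rw [vertexNext_even hc]
      omega
    · rw [vertexNext_odd hc]
      obtain ⟨a, b⟩ := hodd p hp hpz hc
      have := h.next_lt _ a b
      omega
  case lt_rank_next =>
    intro p hp hpz
    by_cases hc : p % 2 = 0 ∧ p < 2 * D.len
    · rw [vertexNext_even hc]
      unfold vertexRank
      rw [show (p + 1) / 2 = p / 2 by omega]
      omega
    · rw [vertexNext_odd hc]
      obtain ⟨a, b⟩ := hodd p hp hpz hc
      have := h.lt_rank_next _ a b
      unfold vertexRank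
      rw [show 2 * nx (p / 2) / 2 = nx (p / 2) by omega]
      omega
  case rank_next_le =>
    intro p hp hpz x hx hlt
    by_cases hc : p % 2 = 0 ∧ p < 2 * D.len
    · rw [vertexNext_even hc]
      unfold vertexRank at hlt ⊢
      rw [show (p + 1) / 2 = p / 2 by omega]
      omega
    · rw [vertexNext_odd hc]
      obtain ⟨a, b⟩ := hodd p hp hpz hc
      have h1 := h.rank_inj _ a (x / 2) (by omega)
      have h2 := h.rank_next_le _ a b (x / 2) (by omega)
      unfold vertexRank at hlt ⊢
      rw [show 2 * nx (p / 2) / 2 = nx (p / 2) by omega]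
      omega
  case time_pos =>
    intro p hp hpz
    by_cases hc : p % 2 = 0 ∧ p < 2 * D.len
    · rw [vertexTime_even hc]
      omega
    · rw [vertexTime_odd hc]
      obtain ⟨a, b⟩ := hodd p hp hpz hc
      exact h.time_pos _ a b
  case time_lt =>
    intro p hp hpz
    by_cases hc : p % 2 = 0 ∧ p < 2 * D.len
    · rw [vertexTime_even hc]
      omega
    · rw [vertexTime_odd hc]
      obtain ⟨a, b⟩ := hodd p hp hpz hc
      have := h.time_lt _ a b
      omega
  case time_inj =>
    intro p hp hpz q hq hqz hpq
    by_cases hc : p % 2 = 0 ∧ p < 2 * D.len <;> by_cases hd : q % 2 = 0 ∧ q < 2 * D.len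
    · rw [vertexTime_even hc, vertexTime_even hd] at hpq
      omega
    · rw [vertexTime_even hc, vertexTime_odd hd] at hpq
      obtain ⟨a, b⟩ := hodd q hq hqz hd
      have := h.time_lt _ a b
      omega
    · rw [vertexTime_odd hc, vertexTime_even hd] at hpq
      obtain ⟨a, b⟩ := hodd p hp hpz hc
      have := h.time_lt _ a b
      omega
    · rw [vertexTime_odd hc, vertexTime_odd hd] at hpq
      obtain ⟨a, b⟩ := hodd p hp hpz hc
      obtain ⟨a', b'⟩ := hodd q hq hqz hd
      have := h.time_inj _ a b _ a' b' hpq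
      omega
  case matched =>
    intro p hp hpz h2
    by_cases hc : p % 2 = 0 ∧ p < 2 * D.len
    · rw [vertexTime_even hc, vertexNext_even hc]
      have := matched_pair hD h hX (p := p / 2) (by omega)
      rwa [show 2 * (p / 2) = p by omega] at this
    · rw [vertexTime_odd hc] at h2 ⊢
      rw [vertexNext_odd hc]
      obtain ⟨a, b⟩ := hodd p hp hpz hc
      have hlt := h.time_lt _ a b
      have hn := h.next_lt _ a b
      -- Replacing `x₁` by `x₂` at the vertex `1` is harmless here: all cuts of the quotient have
      -- time below `len + single`, and `x₁`, `x₂` are linked for long enough.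
      have hX' : Linked (D.len + D.single) ρ τ (τ (p / 2) - 2) D.x₁ D.x₂ := hX.mono (by omega)
      have hn' : 2 * nx (p / 2) < 2 * D.len + D.single := by omega
      refine rel_map_half hD h (by omega) (fun x hx => vertexNb_lt hD hp hx)
        (fun x hx => vertexNb_lt hD hn' hx) ?_
      have r1 := rel_map_vertexNb hD hX' hp
      have r2 := h.matched _ a b h2
      have r3 := rel_map_vertexNb hD hX' hn'
      rw [show 2 * nx (p / 2) / 2 = nx (p / 2) by omega] at r3
      have : IsTrans ℕ (Linked (D.len + D.single) ρ τ (τ (p / 2) - 2)) :=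
        ⟨fun _ _ _ => Linked.trans⟩
      refine Multiset.Rel.trans _ (r1.trans _ r2) ?_
      rw [← Multiset.rel_flip]
      exact r3.mono fun x _ y _ hxy => hxy.symm
  case unmatched =>
    intro p hp hpz
    by_cases hc : p % 2 = 0 ∧ p < 2 * D.len
    · right
      rw [vertexTime_even hc, vertexNext_even hc]
      rcases Nat.eq_zero_or_pos p with rfl | hp0
      · obtain ⟨x, hx, hxz, ht, hcount⟩ := unmatched_zero hD h hX
        exact ⟨x, hx, by omega, by omega, hcount⟩
      · have := unmatched_pos h (p := p / 2) (by omega) (by omega)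
        rw [show 2 * (p / 2) = p by omega] at this
        refine ⟨2 * (p / 2 - 1), by omega, by omega, ?_, this⟩
        rw [vertexTime_even (by omega)]
        omega
    · rw [vertexTime_odd hc, vertexNext_odd hc]
      obtain ⟨a, b⟩ := hodd p hp hpz hc
      have hn := h.next_lt _ a b
      have hn' : 2 * nx (p / 2) < 2 * D.len + D.single := by omega
      have hh : 2 * nx (p / 2) / 2 = nx (p / 2) := by omega
      rcases h.unmatched _ a b with ⟨h1, hlen⟩ | ⟨x, hx, hxz, ht, hcount⟩
      · left
        rw [length_vertexNb hD hp, length_vertexNb hD hn', hh]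
        exact ⟨h1, hlen⟩
      · right
        obtain ⟨y, hy, hyx, hyt, hyr⟩ := exists_vertex_cut hD h hx
        refine ⟨y, hy, by omega, by omega, ?_⟩
        -- The cut after `x` precedes another cut of the quotient, so it is not the last one and
        -- leaves `x₁` and `x₂` on the same side. Hence the vertex `1` counts like the vertex `0`.
        have hXx : decide (ρ D.x₁ ≤ ρ x) = decide (ρ D.x₂ ≤ ρ x) := by
          rw [decide_eq_decide]
          have hlt := h.time_lt _ a b
          have := hX x hx
          omega
        have key : ∀ v < 2 * D.len + D.single,
            (D.vertexNb v).countP (fun w => decide (vertexRank ρ w ≤ vertexRank ρ y)) =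
              (D.pairNb (v / 2)).countP (fun w => decide (ρ w ≤ ρ x)) := by
          intro v hv
          rw [← countP_map_vertexNb hD hv hXx, List.countP_map]
          refine List.countP_congr fun w hw => ?_
          simp only [Function.comp, decide_eq_true_eq]
          exact hyr w (vertexNb_lt hD hv hw)
        rw [key p hp, key _ hn', hh]
        exact hcount

/-- Long-refinement graphs with degrees `2` and `3` from certificates for strings of pairs. -/
theorem existsLongRefinementTwoThree (hD : D.Valid)
    (h : SplitCertificate (D.len + D.single) D.pairNb ρ τ nx z) (hz : z < D.len)
    (hX : Linked (D.len + D.single) ρ τ (D.len + D.single - 2) D.x₁ D.x₂)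
    (hdeg : ∀ p < D.len + D.single, (D.pairNb p).length = 2 ∨ (D.pairNb p).length = 3)
    (htwo : ∃ p < D.len + D.single, (D.pairNb p).length = 2) :
    ExistsLongRefinementTwoThree (2 * D.len + D.single) := by
  have hs := hD.single_le
  refine ⟨_, inferInstance, D.graph hD, inferInstance, Fintype.card_fin _, ?_, ?_⟩
  · exact (lift_certificate hD h hz hX).isLongRefinement (neighborFinset_graph hD)
  · ext d
    unfold degreeSet
    simp only [Set.mem_range, Set.mem_insert_iff, Set.mem_singleton_iff]
    constructor
    · rintro ⟨v, rfl⟩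
      have hv := v.2
      rw [degree_graph hD]
      exact hdeg _ (by omega)
    · rintro (rfl | rfl)
      · obtain ⟨p, hp, hp2⟩ := htwo
        refine ⟨⟨2 * p, by omega⟩, ?_⟩
        rw [degree_graph hD]
        simpa using hp2
      · have := hD.x₁_lt
        refine ⟨⟨0, by omega⟩, ?_⟩
        rw [degree_graph hD]
        unfold pairNb
        rw [if_neg (by simp; omega), if_pos (by simp)]
        rfl

end Lift

end PairString

/-! ### Neighbourhoods that differ in exactly one place -/

/-- Two lists of nodes that match up to time `t`, where time `t + 1` cuts exactly one of the matched
pairs. -/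
def Separated (N : ℕ) (ρ τ : ℕ → ℕ) (z t : ℕ) (L L' : List ℕ) : Prop :=
  ∃ a a' K K', L.Perm (a :: K) ∧ L'.Perm (a' :: K') ∧
    Multiset.Rel (Linked N ρ τ (t + 1)) (K : Multiset ℕ) (K' : Multiset ℕ) ∧
    Linked N ρ τ t a a' ∧ ∃ x < N, x ≠ z ∧ τ x = t + 1 ∧
      ((ρ a ≤ ρ x ∧ ρ x < ρ a') ∨ (ρ a' ≤ ρ x ∧ ρ x < ρ a))

section Separated

variable {N : ℕ} {ρ τ : ℕ → ℕ} {z t : ℕ} {L L' : List ℕ}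

theorem Separated.rel (h : Separated N ρ τ z t L L') :
    Multiset.Rel (Linked N ρ τ t) (L : Multiset ℕ) (L' : Multiset ℕ) := by
  obtain ⟨a, a', K, K', hL, hL', hK, ha, -⟩ := h
  rw [Multiset.coe_eq_coe.2 hL, Multiset.coe_eq_coe.2 hL']
  exact PairString.rel_coe_cons ha (hK.mono fun _ _ _ _ hxy => hxy.mono (Nat.le_succ t))

theorem countP_eq_of_rel {P : ℕ → Bool} {s s' : Multiset ℕ}
    (h : Multiset.Rel (fun a b => P a = P b) s s') :
    s.countP (fun a => P a = true) = s'.countP (fun a => P a = true) := by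
  induction h with
  | zero => rfl
  | cons hab _ ih => simp only [Multiset.countP_cons, ih, hab]

/-- Every matched pair except one lies on one side of the cut, and the exceptional pair contributes
to just one of the two counts. With a single exception nothing can cancel. -/
theorem Separated.countP_ne (h : Separated N ρ τ z t L L') :
    ∃ x < N, x ≠ z ∧ τ x = t + 1 ∧
      L.countP (fun w => decide (ρ w ≤ ρ x)) ≠ L'.countP (fun w => decide (ρ w ≤ ρ x)) := by
  obtain ⟨a, a', K, K', hL, hL', hK, -, x, hx, hxz, hτ, hsep⟩ := h
  refine ⟨x, hx, hxz, hτ, ?_⟩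
  rw [hL.countP_eq, hL'.countP_eq]
  have hKc := countP_eq_of_rel (P := fun w => decide (ρ w ≤ ρ x)) (hK.mono fun b _ b' _ hb => by
    rw [decide_eq_decide]
    have := hb x hx
    omega)
  rw [Multiset.coe_countP, Multiset.coe_countP] at hKc
  simp only [Bool.decide_eq_true] at hKc
  simp only [List.countP_cons, decide_eq_true_eq, hKc]
  split_ifs <;> omega

variable {a b c a' b' c' : ℕ}

theorem separated_of_perm {K K' : List ℕ} (hL : L.Perm K) (hL' : L'.Perm K')
    (h : Separated N ρ τ z t K K') : Separated N ρ τ z t L L' := by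
  obtain ⟨a, a', M, M', hK, hK', h⟩ := h
  exact ⟨a, a', M, M', hL.trans hK, hL'.trans hK', h⟩

theorem separated_pair (hb : Linked N ρ τ (t + 1) b b') (ha : Linked N ρ τ t a a') (x : ℕ)
    (hx : x < N ∧ x ≠ z ∧ τ x = t + 1 ∧
      ((ρ a ≤ ρ x ∧ ρ x < ρ a') ∨ (ρ a' ≤ ρ x ∧ ρ x < ρ a))) :
    Separated N ρ τ z t [a, b] [a', b'] :=
  ⟨a, a', [b], [b'], .refl _, .refl _, PairString.rel_coe_cons hb Multiset.Rel.zero, ha, x, hx⟩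

theorem separated_triple (hb : Linked N ρ τ (t + 1) b b') (hc : Linked N ρ τ (t + 1) c c')
    (ha : Linked N ρ τ t a a') (x : ℕ)
    (hx : x < N ∧ x ≠ z ∧ τ x = t + 1 ∧
      ((ρ a ≤ ρ x ∧ ρ x < ρ a') ∨ (ρ a' ≤ ρ x ∧ ρ x < ρ a))) :
    Separated N ρ τ z t [a, b, c] [a', b', c'] :=
  ⟨a, a', [b, c], [b', c'], .refl _, .refl _,
    PairString.rel_coe_cons hb (PairString.rel_coe_cons hc Multiset.Rel.zero), ha, x, hx⟩

/-- A certificate in terms of exact ranks and `Separated`. -/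
theorem SplitCertificate.of_separated {nb : ℕ → List ℕ} {nx : ℕ → ℕ}
    (hz : z < N) (hinj : ∀ p < N, ∀ q < N, ρ p = ρ q → p = q) (hle : ∀ p < N, ρ p ≤ ρ z)
    (hnext : ∀ p < N, p ≠ z → nx p < N ∧ ρ (nx p) = ρ p + 1 ∧ 0 < τ p ∧ τ p < N)
    (htime : ∀ p < N, p ≠ z → ∀ q < N, q ≠ z → τ p = τ q → p = q)
    (hfirst : ∀ p < N, p ≠ z → τ p = 1 → (nb p).length ≠ (nb (nx p)).length)
    (hsep : ∀ p < N, p ≠ z → ∀ t, τ p = t + 2 → Separated N ρ τ z t (nb p) (nb (nx p))) :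
    SplitCertificate N nb ρ τ nx z where
  last_lt := hz
  rank_inj := hinj
  rank_le_last := hle
  next_lt p hp hpz := (hnext p hp hpz).1
  lt_rank_next p hp hpz := by
    rw [(hnext p hp hpz).2.1]
    omega
  rank_next_le p hp hpz x _ hlt := by
    rw [(hnext p hp hpz).2.1]
    omega
  time_pos p hp hpz := (hnext p hp hpz).2.2.1
  time_lt p hp hpz := (hnext p hp hpz).2.2.2
  time_inj := htime
  matched p hp hpz ht := (hsep p hp hpz (τ p - 2) (by omega)).rel
  unmatched p hp hpz := by
    by_cases h1 : τ p = 1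
    · exact Or.inl ⟨h1, hfirst p hp hpz h1⟩
    · have h0 := (hnext p hp hpz).2.2.1
      obtain ⟨x, hx, hxz, hτ, hc⟩ := (hsep p hp hpz (τ p - 2) (by omega)).countP_ne
      exact Or.inr ⟨x, hx, hxz, by omega, hc⟩

end Separated

/-! ### Neighbour lists in the quotient -/

namespace PairString

section PairNb

variable {D : PairString} {p : ℕ}

theorem pairNb_len : D.pairNb D.len = [D.anchor, D.anchor] := if_pos rfl

theorem pairNb_zero (hl : 0 < D.len) : D.pairNb 0 = [1, D.x₁, D.x₁] := by
  unfold pairNb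
  rw [if_neg (by omega), if_pos rfl]

theorem pairNb_of_pos (hp : 0 < p) (hpl : p < D.len) :
    D.pairNb p = (p - 1) :: ((if p + 1 < D.len then [p + 1] else []) ++
      ((if D.loop p then [p] else []) ++ ((if p = D.x₁ then [0] else []) ++
      ((if p = D.x₂ then [0] else []) ++
      (if D.single = 1 ∧ p = D.anchor then [D.len] else []))))) := by
  unfold pairNb
  rw [if_neg (by omega), if_neg (by omega)]

theorem pairNb_loop (hp : 0 < p) (hpl : p + 1 < D.len) (hl : D.loop p) (h1 : p ≠ D.x₁)
    (h2 : p ≠ D.x₂) (ha : ¬ (D.single = 1 ∧ p = D.anchor)) : D.pairNb p = [p - 1, p + 1, p] := by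
  rw [pairNb_of_pos hp (by omega), if_pos hpl, if_pos hl, if_neg h1, if_neg h2, if_neg ha]
  rfl

theorem pairNb_plain (hp : 0 < p) (hpl : p + 1 < D.len) (hl : ¬ D.loop p) (h1 : p ≠ D.x₁)
    (h2 : p ≠ D.x₂) (ha : ¬ (D.single = 1 ∧ p = D.anchor)) : D.pairNb p = [p - 1, p + 1] := by
  rw [pairNb_of_pos hp (by omega), if_pos hpl, if_neg hl, if_neg h1, if_neg h2, if_neg ha]
  rfl

theorem pairNb_x₁ (hp : 0 < p) (hpl : p + 1 < D.len) (hl : ¬ D.loop p) (h1 : p = D.x₁)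
    (h2 : p ≠ D.x₂) (ha : ¬ (D.single = 1 ∧ p = D.anchor)) : D.pairNb p = [p - 1, p + 1, 0] := by
  rw [pairNb_of_pos hp (by omega), if_pos hpl, if_neg hl, if_pos h1, if_neg h2, if_neg ha]
  rfl

theorem pairNb_x₂ (hp : 0 < p) (hpl : p + 1 < D.len) (hl : ¬ D.loop p) (h1 : p ≠ D.x₁)
    (h2 : p = D.x₂) (ha : ¬ (D.single = 1 ∧ p = D.anchor)) : D.pairNb p = [p - 1, p + 1, 0] := by
  rw [pairNb_of_pos hp (by omega), if_pos hpl, if_neg hl, if_neg h1, if_pos h2, if_neg ha]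
  rfl

theorem pairNb_anchor (hp : 0 < p) (hpl : p + 1 < D.len) (hl : ¬ D.loop p) (h1 : p ≠ D.x₁)
    (h2 : p ≠ D.x₂) (ha : D.single = 1 ∧ p = D.anchor) :
    D.pairNb p = [p - 1, p + 1, D.len] := by
  rw [pairNb_of_pos hp (by omega), if_pos hpl, if_neg hl, if_neg h1, if_neg h2, if_pos ha]
  rfl

theorem pairNb_last (hp : 0 < p) (hpl : p + 1 = D.len) (hl : D.loop p) (h1 : p ≠ D.x₁)
    (h2 : p ≠ D.x₂) (ha : ¬ (D.single = 1 ∧ p = D.anchor)) : D.pairNb p = [p - 1, p] := by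
  rw [pairNb_of_pos hp (by omega), if_neg hpl.not_lt, if_pos hl, if_neg h1, if_neg h2, if_neg ha]
  rfl

theorem pairNb_last_anchor (hp : 0 < p) (hpl : p + 1 = D.len) (hl : D.loop p) (h1 : p ≠ D.x₁)
    (h2 : p ≠ D.x₂) (ha : D.single = 1 ∧ p = D.anchor) : D.pairNb p = [p - 1, p, D.len] := by
  rw [pairNb_of_pos hp (by omega), if_neg hpl.not_lt, if_pos hl, if_neg h1, if_neg h2, if_pos ha]
  rfl

theorem pairNb_last_x₂ (hp : 0 < p) (hpl : p + 1 = D.len) (hl : ¬ D.loop p) (h1 : p ≠ D.x₁)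
    (h2 : p = D.x₂) (ha : D.single = 1 ∧ p = D.anchor) : D.pairNb p = [p - 1, 0, D.len] := by
  rw [pairNb_of_pos hp (by omega), if_neg hpl.not_lt, if_neg hl, if_neg h1, if_pos h2, if_pos ha]
  rfl

end PairNb

end PairString

theorem perm_rotate_left (a b c : ℕ) : [a, b, c].Perm [b, c, a] :=
  (List.Perm.swap b a [c]).trans ((List.Perm.swap c a []).cons b)

theorem perm_rotate_right (a b c : ℕ) : [a, b, c].Perm [c, a, b] :=
  (perm_rotate_left c a b).symm

namespace PairString

/-! ### The family `fold`: residues 1, 2, 4, 5 modulo 6 -/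

/-- Three arms with `m` levels and loops everywhere, except next to the fold between the first two
arms and at the pairs `x₁` and `x₂`. There are `e` further pairs between the second and the third
arm. If `δ = 1`, then the fold is a pair and the third arm ends in a single vertex. -/
def fold (m δ e : ℕ) : PairString where
  len := 3 * m + δ + e
  single := δ
  -- For `e = 1`, the pairs `x₁` and `x₂` are the outermost pairs of the second and third arm; for
  -- `e = 2`, they are the two further pairs. Either way they are in the same class until the last
  -- round.
  x₁ := 2 * m + δ - 2 + e
  x₂ := 2 * m + δ + 1
  anchor := 3 * m + δ + e - 1
  -- This leaves degree two only innermost: for `δ = 0` at the two pairs of the fold and at the end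
  -- of the third arm, for `δ = 1` at the fold pair and the single vertex.
  loop p := p ≠ m ∧ p + 1 ≠ m + δ ∧ p ≠ 2 * m + δ - 2 + e ∧ p ≠ 2 * m + δ + 1
  decLoop _ := inferInstance

/-- The rank in the quotient of `fold`: level by level, beginning at the fold. -/
def foldRank (m δ e p : ℕ) : ℕ :=
  if p < m then 2 * δ + 3 * (m - 1 - p)
  else if p < 2 * m + δ then 3 * p + 1 - 3 * m - δ
  else if p < 2 * m + δ + e then m + δ + p
  else 2 * δ + 3 * (3 * m + δ + e) - 3 * p - 1

/-- The times of the cuts in the quotient of `fold`: first the levels are separated, then the arms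
within the levels in the order of the string. -/
def foldTime (m δ e p : ℕ) : ℕ :=
  -- The second formula is the level phase, counted from the end of the third arm, whose node is the
  -- last one of its level. The value at the node of highest rank plays no role.
  if p + 1 < 2 * m + δ + e then m + 1 + δ + p else 3 * m + δ + e + δ - p

/-- The successor with respect to `foldRank`. -/
def foldNext (m δ e p : ℕ) : ℕ :=
  if p < m then 2 * m + δ - 1 - p
  else if p < 2 * m + δ then 3 * m + δ + e - 1 + m + δ - p
  else if p < 2 * m + δ + e then p + 1
  else if p = 2 * m + δ + e then 2 * m + δ
  else p + m - 1 - (3 * m + δ + e)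

/-- Admissible parameters of `fold`. -/
structure FoldParameters (m δ e : ℕ) : Prop where
  fold_le : δ ≤ 1
  one_le : 1 ≤ e
  le_two : e ≤ 2
  pos : 1 ≤ m
  -- For `δ = 0` and `m = 1`, the pair `0` would lie at the fold, where degree two is needed, but
  -- its degree is three.
  two_le : 2 ≤ m + δ

theorem foldRank_spec {m δ e p : ℕ} (h : FoldParameters m δ e) (hp : p < 3 * m + δ + e + δ) :
    (p < m ∧ foldRank m δ e p + 3 * p + 3 = 2 * δ + 3 * m) ∨
    (m ≤ p ∧ p < 2 * m + δ ∧ foldRank m δ e p + 3 * m + δ = 3 * p + 1) ∨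
    (2 * m + δ ≤ p ∧ p < 2 * m + δ + e ∧ foldRank m δ e p = m + δ + p) ∨
    (2 * m + δ + e ≤ p ∧ foldRank m δ e p + 3 * p + 1 = 2 * δ + 3 * (3 * m + δ + e)) := by
  obtain ⟨h1, h2, h3, h4, h5⟩ := h
  unfold foldRank
  split_ifs <;> omega

theorem foldTime_spec {m δ e p : ℕ} (hp : p < 3 * m + δ + e + δ) :
    (p + 1 < 2 * m + δ + e ∧ foldTime m δ e p = m + 1 + δ + p) ∨
    (2 * m + δ + e ≤ p + 1 ∧ foldTime m δ e p + p = 3 * m + δ + e + δ) := by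
  unfold foldTime
  split_ifs <;> omega

theorem foldNext_spec (m δ e p : ℕ) :
    (p < m ∧ foldNext m δ e p = 2 * m + δ - 1 - p) ∨
    (m ≤ p ∧ p < 2 * m + δ ∧ foldNext m δ e p = 3 * m + δ + e - 1 + m + δ - p) ∨
    (2 * m + δ ≤ p ∧ p < 2 * m + δ + e ∧ foldNext m δ e p = p + 1) ∨
    (p = 2 * m + δ + e ∧ foldNext m δ e p = 2 * m + δ) ∨
    (2 * m + δ + e < p ∧ foldNext m δ e p = p + m - 1 - (3 * m + δ + e)) := by
  unfold foldNext
  split_ifs <;> omega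

/-- Linked nodes in the quotient of `fold`, with explicit ranks and times. -/
theorem fold_linked {m δ e t p q : ℕ} (h : FoldParameters m δ e)
    (hpq : p < 3 * m + δ + e + δ ∧ q < 3 * m + δ + e + δ)
    -- Ranks and times are replaced by variables with piecewise linear descriptions, so that every
    -- instance is a goal for `omega`.
    (H : ∀ x rx rp rq tx : ℕ, x < 3 * m + δ + e + δ →
      ((x + 1 < 2 * m + δ + e ∧ tx = m + 1 + δ + x) ∨
        (2 * m + δ + e ≤ x + 1 ∧ tx + x = 3 * m + δ + e + δ)) →
      ((x < m ∧ rx + 3 * x + 3 = 2 * δ + 3 * m) ∨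
        (m ≤ x ∧ x < 2 * m + δ ∧ rx + 3 * m + δ = 3 * x + 1) ∨
        (2 * m + δ ≤ x ∧ x < 2 * m + δ + e ∧ rx = m + δ + x) ∨
        (2 * m + δ + e ≤ x ∧ rx + 3 * x + 1 = 2 * δ + 3 * (3 * m + δ + e))) →
      (rp ≤ rx ∧ rx < rq) ∨ (rq ≤ rx ∧ rx < rp) →
      ((p < m ∧ rp + 3 * p + 3 = 2 * δ + 3 * m) ∨
        (m ≤ p ∧ p < 2 * m + δ ∧ rp + 3 * m + δ = 3 * p + 1) ∨
        (2 * m + δ ≤ p ∧ p < 2 * m + δ + e ∧ rp = m + δ + p) ∨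
        (2 * m + δ + e ≤ p ∧ rp + 3 * p + 1 = 2 * δ + 3 * (3 * m + δ + e))) →
      ((q < m ∧ rq + 3 * q + 3 = 2 * δ + 3 * m) ∨
        (m ≤ q ∧ q < 2 * m + δ ∧ rq + 3 * m + δ = 3 * q + 1) ∨
        (2 * m + δ ≤ q ∧ q < 2 * m + δ + e ∧ rq = m + δ + q) ∨
        (2 * m + δ + e ≤ q ∧ rq + 3 * q + 1 = 2 * δ + 3 * (3 * m + δ + e))) → t < tx) :
    Linked (3 * m + δ + e + δ) (foldRank m δ e) (foldTime m δ e) t p q := fun x hx _ _ =>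
  H x _ _ _ _ hx (foldTime_spec hx) (foldRank_spec h hx) (by omega) (foldRank_spec h hpq.1)
    (foldRank_spec h hpq.2)

/-- A cut of a given time between two given nodes, with explicit ranks and times. -/
theorem fold_cut {m δ e z t a b x : ℕ} (h : FoldParameters m δ e)
    (hx : x < 3 * m + δ + e + δ ∧ x ≠ z ∧ a < 3 * m + δ + e + δ ∧ b < 3 * m + δ + e + δ)
    (H : ∀ ra rb rx tx : ℕ,
      ((x + 1 < 2 * m + δ + e ∧ tx = m + 1 + δ + x) ∨
        (2 * m + δ + e ≤ x + 1 ∧ tx + x = 3 * m + δ + e + δ)) →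
      ((x < m ∧ rx + 3 * x + 3 = 2 * δ + 3 * m) ∨
        (m ≤ x ∧ x < 2 * m + δ ∧ rx + 3 * m + δ = 3 * x + 1) ∨
        (2 * m + δ ≤ x ∧ x < 2 * m + δ + e ∧ rx = m + δ + x) ∨
        (2 * m + δ + e ≤ x ∧ rx + 3 * x + 1 = 2 * δ + 3 * (3 * m + δ + e))) →
      ((a < m ∧ ra + 3 * a + 3 = 2 * δ + 3 * m) ∨
        (m ≤ a ∧ a < 2 * m + δ ∧ ra + 3 * m + δ = 3 * a + 1) ∨
        (2 * m + δ ≤ a ∧ a < 2 * m + δ + e ∧ ra = m + δ + a) ∨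
        (2 * m + δ + e ≤ a ∧ ra + 3 * a + 1 = 2 * δ + 3 * (3 * m + δ + e))) →
      ((b < m ∧ rb + 3 * b + 3 = 2 * δ + 3 * m) ∨
        (m ≤ b ∧ b < 2 * m + δ ∧ rb + 3 * m + δ = 3 * b + 1) ∨
        (2 * m + δ ≤ b ∧ b < 2 * m + δ + e ∧ rb = m + δ + b) ∨
        (2 * m + δ + e ≤ b ∧ rb + 3 * b + 1 = 2 * δ + 3 * (3 * m + δ + e))) →
      tx = t ∧ ((ra ≤ rx ∧ rx < rb) ∨ (rb ≤ rx ∧ rx < ra))) :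
    x < 3 * m + δ + e + δ ∧ x ≠ z ∧ foldTime m δ e x = t ∧
      ((foldRank m δ e a ≤ foldRank m δ e x ∧ foldRank m δ e x < foldRank m δ e b) ∨
        (foldRank m δ e b ≤ foldRank m δ e x ∧ foldRank m δ e x < foldRank m δ e a)) :=
  ⟨hx.1, hx.2.1, H _ _ _ _ (foldTime_spec hx.1) (foldRank_spec h hx.1)
    (foldRank_spec h hx.2.2.1) (foldRank_spec h hx.2.2.2)⟩

section Fold

variable {m δ e : ℕ}

theorem FoldParameters.valid (h : FoldParameters m δ e) : (fold m δ e).Valid := by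
  obtain ⟨h1, h2, h3, h4, h5⟩ := h
  constructor <;> (try simp only [fold]) <;> omega

theorem FoldParameters.rank_inj (h : FoldParameters m δ e) : ∀ p < 3 * m + δ + e + δ,
    ∀ q < 3 * m + δ + e + δ, foldRank m δ e p = foldRank m δ e q → p = q := by
  have h' := h
  obtain ⟨h1, h2, h3, h4, h5⟩ := h
  intro p hp q hq
  have := foldRank_spec h' hp
  have := foldRank_spec h' hq
  omega

theorem FoldParameters.rank_le (h : FoldParameters m δ e) : ∀ p < 3 * m + δ + e + δ,
    foldRank m δ e p ≤ foldRank m δ e (2 * m + δ + e - 1) := by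
  have h' := h
  obtain ⟨h1, h2, h3, h4, h5⟩ := h
  intro p hp
  have := foldRank_spec h' hp
  have := foldRank_spec (p := 2 * m + δ + e - 1) h' (by omega)
  omega

theorem FoldParameters.next_spec (h : FoldParameters m δ e) :
    ∀ p < 3 * m + δ + e + δ, p ≠ 2 * m + δ + e - 1 →
      foldNext m δ e p < 3 * m + δ + e + δ ∧
      foldRank m δ e (foldNext m δ e p) = foldRank m δ e p + 1 ∧
      0 < foldTime m δ e p ∧ foldTime m δ e p < 3 * m + δ + e + δ := by
  have h' := h
  obtain ⟨h1, h2, h3, h4, h5⟩ := h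
  intro p hp hpz
  have := foldRank_spec h' hp
  have := foldTime_spec hp
  have := foldNext_spec m δ e p
  have := foldRank_spec (p := foldNext m δ e p) h' (by omega)
  omega

theorem FoldParameters.time_inj (h : FoldParameters m δ e) :
    ∀ p < 3 * m + δ + e + δ, p ≠ 2 * m + δ + e - 1 →
      ∀ q < 3 * m + δ + e + δ, q ≠ 2 * m + δ + e - 1 →
        foldTime m δ e p = foldTime m δ e q → p = q := by
  obtain ⟨h1, h2, h3, h4, h5⟩ := h
  intro p hp hpz q hq hqz
  have := foldTime_spec hp
  have := foldTime_spec hq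
  omega

theorem fold_zero (h : FoldParameters m δ e) :
    (fold m δ e).pairNb 0 = [1, 2 * m + δ - 2 + e, 2 * m + δ - 2 + e] := by
  obtain ⟨h1, h2, h3, h4, h5⟩ := h
  exact pairNb_zero (by simp only [fold]; omega)

theorem fold_loop {p : ℕ} (h : FoldParameters m δ e) (hp : 0 < p ∧ p + 1 < 3 * m + δ + e)
    (hl : p ≠ m ∧ p + 1 ≠ m + δ ∧ p ≠ 2 * m + δ - 2 + e ∧ p ≠ 2 * m + δ + 1) :
    (fold m δ e).pairNb p = [p - 1, p + 1, p] := by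
  obtain ⟨h1, h2, h3, h4, h5⟩ := h
  apply pairNb_loop <;> (try simp only [fold]) <;> omega

theorem fold_plain {p : ℕ} (h : FoldParameters m δ e) (hp : 0 < p ∧ p + 1 < 3 * m + δ + e)
    (hl : p = m ∨ p + 1 = m + δ) : (fold m δ e).pairNb p = [p - 1, p + 1] := by
  obtain ⟨h1, h2, h3, h4, h5⟩ := h
  apply pairNb_plain <;> (try simp only [fold]) <;> omega

theorem fold_x₁ {p : ℕ} (h : FoldParameters m δ e) (hp : p = 2 * m + δ - 2 + e) :
    (fold m δ e).pairNb p = [p - 1, p + 1, 0] := by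
  obtain ⟨h1, h2, h3, h4, h5⟩ := h
  apply pairNb_x₁ <;> (try simp only [fold]) <;> omega

theorem fold_x₂ {p : ℕ} (h : FoldParameters m δ e) (hp : p = 2 * m + δ + 1)
    (hl : p + 1 < 3 * m + δ + e) : (fold m δ e).pairNb p = [p - 1, p + 1, 0] := by
  obtain ⟨h1, h2, h3, h4, h5⟩ := h
  apply pairNb_x₂ <;> (try simp only [fold]) <;> omega

theorem fold_last {p : ℕ} (h : FoldParameters m δ e) (hp : p + 1 = 3 * m + δ + e) (hδ : δ = 0) :
    (fold m δ e).pairNb p = [p - 1, p] := by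
  obtain ⟨h1, h2, h3, h4, h5⟩ := h
  apply pairNb_last <;> (try simp only [fold]) <;> omega

theorem fold_last_anchor {p : ℕ} (h : FoldParameters m δ e) (hp : p + 1 = 3 * m + δ + e)
    (hδ : δ = 1) (hme : 3 ≤ m + e) : (fold m δ e).pairNb p = [p - 1, p, 3 * m + δ + e] := by
  obtain ⟨h1, h2, h3, h4, h5⟩ := h
  apply pairNb_last_anchor <;> (try simp only [fold]) <;> omega

theorem fold_last_x₂ {p : ℕ} (h : FoldParameters m δ e) (hp : p + 1 = 3 * m + δ + e)
    (hδ : δ = 1) (hme : m + e < 3) : (fold m δ e).pairNb p = [p - 1, 0, 3 * m + δ + e] := by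
  obtain ⟨h1, h2, h3, h4, h5⟩ := h
  apply pairNb_last_x₂ <;> (try simp only [fold]) <;> omega

theorem fold_single {p : ℕ} (hp : p = 3 * m + δ + e) :
    (fold m δ e).pairNb p = [p - 1, p - 1] := by
  subst hp
  exact pairNb_len

end Fold

section Fold

variable {m δ e : ℕ}

/-- The condition of the certificate for two given nodes of the quotient of `fold`. -/
abbrev FoldSeparated (m δ e t p q : ℕ) : Prop :=
  Separated (3 * m + δ + e + δ) (foldRank m δ e) (foldTime m δ e) (2 * m + δ + e - 1) t
    ((fold m δ e).pairNb p) ((fold m δ e).pairNb q)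

/-- The second phase begins when the further pairs have been cut off from the outermost level. The
double edge from `0` to `x₁` then shows: for `e = 1` it stays within the level, where other nodes
have a neighbour beyond; for `e = 2` it gives two neighbours beyond instead of one. -/
theorem fold_separated_start {t : ℕ} (h : FoldParameters m δ e) (ht : t + 1 = m + δ) :
    FoldSeparated m δ e t 0 (2 * m + δ - 1) := by
  unfold FoldSeparated
  have h' := h
  obtain ⟨h1, h2, h3, h4, h5⟩ := h
  rw [fold_zero h']
  by_cases he : e = 1
  · rw [fold_x₁ h' (by omega)]
    refine separated_of_perm (List.Perm.swap _ _ _) (List.Perm.swap _ _ _)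
      (separated_triple (fold_linked h' (by omega) (by omega))
          (fold_linked h' (by omega) (by omega)) (fold_linked h' (by omega) (by omega))
        (2 * m + δ + 1) (fold_cut h' (by omega) (by omega)))
  · rw [fold_loop h' (by omega) (by omega)]
    refine separated_of_perm (perm_rotate_right _ _ _) (perm_rotate_right _ _ _)
      (separated_triple (fold_linked h' (by omega) (by omega))
          (fold_linked h' (by omega) (by omega)) (fold_linked h' (by omega) (by omega))
        (2 * m + δ + 2) (fold_cut h' (by omega) (by omega)))

/-- Going down the first arm: the node `p - 1` has just been cut off from the rest of its level, and
this singles out `p`. -/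
theorem fold_separated_first {t p : ℕ} (h : FoldParameters m δ e) (hp : 0 < p)
    (hpm : p + 1 < m + δ) (hpm' : p < m) (ht : t + 2 = m + 1 + δ + p) :
    FoldSeparated m δ e t p (2 * m + δ - 1 - p) := by
  unfold FoldSeparated
  have h' := h
  obtain ⟨h1, h2, h3, h4, h5⟩ := h
  rw [fold_loop h' (by omega) (by omega), fold_loop h' (by omega) (by omega)]
  refine separated_of_perm (.refl _) (List.Perm.swap _ _ _)
    (separated_triple (fold_linked h' (by omega) (by omega)) (fold_linked h' (by omega) (by omega))
        (fold_linked h' (by omega) (by omega))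
      (p - 1) (fold_cut h' (by omega) (by omega)))

theorem fold_separated_bottom {t p : ℕ} (h : FoldParameters m δ e) (hδ : δ = 0)
    (hp : p + 1 = m) (ht : t + 2 = m + 1 + δ + p) :
    FoldSeparated m δ e t p (2 * m + δ - 1 - p) := by
  unfold FoldSeparated
  have h' := h
  obtain ⟨h1, h2, h3, h4, h5⟩ := h
  rw [fold_plain h' (by omega) (by omega), fold_plain h' (by omega) (by omega)]
  refine separated_of_perm (.refl _) (List.Perm.swap _ _ _)
    (separated_pair (fold_linked h' (by omega) (by omega)) (fold_linked h' (by omega) (by omega))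
        (p - 1)
      (fold_cut h' (by omega) (by omega)))

/-- Going up the second arm: the previous cut has separated `p - 1` from its counterpart on the
third arm. -/
theorem fold_separated_second {t p : ℕ} (h : FoldParameters m δ e) (hp : m + δ < p)
    (hp2 : p + 1 < 2 * m + δ ∨ (p + 1 = 2 * m + δ ∧ e = 2)) (ht : t + 2 = m + 1 + δ + p) :
    FoldSeparated m δ e t p (3 * m + δ + e - 1 + m + δ - p) := by
  unfold FoldSeparated
  have h' := h
  obtain ⟨h1, h2, h3, h4, h5⟩ := h
  rw [fold_loop h' (by omega) (by omega), fold_loop h' (by omega) (by omega)]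
  refine separated_of_perm (.refl _) (List.Perm.swap _ _ _)
    (separated_triple (fold_linked h' (by omega) (by omega)) (fold_linked h' (by omega) (by omega))
        (fold_linked h' (by omega) (by omega))
      (p - 1) (fold_cut h' (by omega) (by omega)))

theorem fold_separated_second_top {t p : ℕ} (h : FoldParameters m δ e) (hp : m + δ < p)
    (hp2 : p + 1 = 2 * m + δ ∧ e = 1) (ht : t + 2 = m + 1 + δ + p) :
    FoldSeparated m δ e t p (3 * m + δ + e - 1 + m + δ - p) := by
  unfold FoldSeparated
  have h' := h
  obtain ⟨h1, h2, h3, h4, h5⟩ := h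
  rw [fold_x₁ h' (by omega), fold_x₂ h' (by omega) (by omega)]
  refine separated_of_perm (.refl _) (List.Perm.swap _ _ _)
    (separated_triple (fold_linked h' (by omega) (by omega)) (Linked.refl _)
        (fold_linked h' (by omega) (by omega))
      (p - 1) (fold_cut h' (by omega) (by omega)))

theorem fold_separated_second_last {t p : ℕ} (h : FoldParameters m δ e) (hp : p = m + δ)
    (hδ : δ = 1) (hme : 3 ≤ m + e) (ht : t + 2 = m + 1 + δ + p) :
    FoldSeparated m δ e t p (3 * m + δ + e - 1 + m + δ - p) := by
  unfold FoldSeparated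
  have h' := h
  obtain ⟨h1, h2, h3, h4, h5⟩ := h
  rw [fold_loop h' (by omega) (by omega), fold_last_anchor h' (by omega) hδ hme]
  refine separated_of_perm (.refl _) (perm_rotate_right _ _ _)
    (separated_triple (fold_linked h' (by omega) (by omega)) (fold_linked h' (by omega) (by omega))
        (fold_linked h' (by omega) (by omega))
      (p - 1) (fold_cut h' (by omega) (by omega)))

theorem fold_separated_second_small {t p : ℕ} (h : FoldParameters m δ e) (hp : p = m + δ)
    (hδ : δ = 1) (hme : m + e < 3) (ht : t + 2 = m + 1 + δ + p) :
    FoldSeparated m δ e t p (3 * m + δ + e - 1 + m + δ - p) := by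
  unfold FoldSeparated
  have h' := h
  obtain ⟨h1, h2, h3, h4, h5⟩ := h
  rw [fold_x₁ h' (by omega), fold_last_x₂ h' (by omega) hδ hme]
  refine separated_of_perm (.refl _)
    ((perm_rotate_right _ _ _).trans ((List.Perm.refl _).cons _))
    (separated_triple (fold_linked h' (by omega) (by omega)) (Linked.refl _)
        (fold_linked h' (by omega) (by omega))
      (p - 1) (fold_cut h' (by omega) (by omega)))

/-- The bend carries the separation to the second arm: `m` is adjacent to the first arm, while the
node compared with it sees only the third arm. -/
theorem fold_separated_fold {t p : ℕ} (h : FoldParameters m δ e) (hp : p = m)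
    (ht : t + 2 = m + 1 + δ + p) :
    FoldSeparated m δ e t p (3 * m + δ + e - 1 + m + δ - p) := by
  unfold FoldSeparated
  have h' := h
  obtain ⟨h1, h2, h3, h4, h5⟩ := h
  rw [fold_plain h' (by omega) (by omega)]
  by_cases hδ : δ = 0
  · rw [fold_last h' (by omega) hδ]
    refine separated_of_perm (.refl _) (List.Perm.swap _ _ _)
      (separated_pair (fold_linked h' (by omega) (by omega)) (fold_linked h' (by omega) (by omega))
          (p - 1)
        (fold_cut h' (by omega) (by omega)))
  · rw [fold_single (by omega)]
    refine separated_pair (fold_linked h' (by omega) (by omega))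
        (fold_linked h' (by omega) (by omega)) (p - 1)
        (fold_cut h' (by omega) (by omega))

/-- For `e = 2` this is the final cut, between `x₁` and `x₂`. -/
theorem fold_separated_middle {t p : ℕ} (h : FoldParameters m δ e) (hp : p = 2 * m + δ)
    (he : e = 2) (ht : t + 2 = m + 1 + δ + p) :
    FoldSeparated m δ e t p (p + 1) := by
  unfold FoldSeparated
  have h' := h
  obtain ⟨h1, h2, h3, h4, h5⟩ := h
  rw [fold_x₁ h' (by omega), fold_x₂ h' (by omega) (by omega)]
  refine separated_of_perm (.refl _) (List.Perm.swap _ _ _)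
    (separated_triple (fold_linked h' (by omega) (by omega)) (Linked.refl _)
        (fold_linked h' (by omega) (by omega))
      (p - 1) (fold_cut h' (by omega) (by omega)))

end Fold

section Fold

variable {m δ e : ℕ}

/-- The level phase: the inner neighbour `p + 1` lies below the previous level cut, while all
neighbours of a node one level further out lie above it. -/
theorem fold_separated_third {t p : ℕ} (h : FoldParameters m δ e)
    (hpl : p + 1 < 3 * m + δ + e) (hr : 3 * m + δ + e + 1 < p + m)
    (ht : t + 2 + p = 3 * m + δ + e + δ) :
    FoldSeparated m δ e t p (p + m - 1 - (3 * m + δ + e)) := by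
  unfold FoldSeparated
  have h' := h
  obtain ⟨h1, h2, h3, h4, h5⟩ := h
  rw [fold_loop h' (by omega) (by omega), fold_loop h' (by omega) (by omega)]
  refine separated_of_perm (List.Perm.swap _ _ _) (List.Perm.swap _ _ _)
    (separated_triple (fold_linked h' (by omega) (by omega)) (fold_linked h' (by omega) (by omega))
      (fold_linked h' (by omega) (by omega)) (p + 1) (fold_cut h' (by omega) (by omega)))

theorem fold_separated_third_start {t p : ℕ} (h : FoldParameters m δ e)
    (hpl : p + 1 < 3 * m + δ + e) (hr : 3 * m + δ + e + 1 = p + m)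
    (ht : t + 2 + p = 3 * m + δ + e + δ) :
    FoldSeparated m δ e t p 0 := by
  unfold FoldSeparated
  have h' := h
  obtain ⟨h1, h2, h3, h4, h5⟩ := h
  rw [fold_loop h' (by omega) (by omega), fold_zero h']
  refine separated_of_perm (List.Perm.swap _ _ _) (.refl _)
    (separated_triple (fold_linked h' (by omega) (by omega)) (fold_linked h' (by omega) (by omega))
      (fold_linked h' (by omega) (by omega)) (p + 1) (fold_cut h' (by omega) (by omega)))

theorem fold_separated_third_last {t p : ℕ} (h : FoldParameters m δ e)
    (hp : 2 * m + δ + e < p) (hpl : p + 1 = 3 * m + δ + e) (hδ : δ = 1)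
    (ht : t + 2 + p = 3 * m + δ + e + δ) :
    FoldSeparated m δ e t p (p + m - 1 - (3 * m + δ + e)) := by
  unfold FoldSeparated
  have h' := h
  obtain ⟨h1, h2, h3, h4, h5⟩ := h
  rw [fold_last_anchor h' (by omega) hδ (by omega)]
  by_cases hm : m = 2
  · rw [show p + m - 1 - (3 * m + δ + e) = 0 by omega, fold_zero h']
    refine separated_of_perm (perm_rotate_right _ _ _) (.refl _)
      (separated_triple (fold_linked h' (by omega) (by omega))
        (fold_linked h' (by omega) (by omega)) (fold_linked h' (by omega) (by omega)) (p + 1)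
        (fold_cut h' (by omega) (by omega)))
  · rw [fold_loop h' (by omega) (by omega)]
    refine separated_of_perm (perm_rotate_right _ _ _) (List.Perm.swap _ _ _)
      (separated_triple (fold_linked h' (by omega) (by omega))
        (fold_linked h' (by omega) (by omega)) (fold_linked h' (by omega) (by omega)) (p + 1)
        (fold_cut h' (by omega) (by omega)))

theorem fold_separated_top {t p : ℕ} (h : FoldParameters m δ e) (hp : p = 2 * m + δ + e)
    (hm : 2 ≤ m) (ht : t + 2 + p = 3 * m + δ + e + δ) :
    FoldSeparated m δ e t p (2 * m + δ) := by
  unfold FoldSeparated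
  have h' := h
  obtain ⟨h1, h2, h3, h4, h5⟩ := h
  by_cases he : e = 1
  · rw [fold_x₂ h' (by omega) (by omega), fold_loop h' (by omega) (by omega)]
    refine separated_of_perm (List.Perm.swap _ _ _) (.refl _)
      (separated_triple (fold_linked h' (by omega) (by omega))
        (fold_linked h' (by omega) (by omega)) (fold_linked h' (by omega) (by omega)) (p + 1)
        (fold_cut h' (by omega) (by omega)))
  · rw [fold_loop h' (by omega) (by omega), fold_x₁ h' (by omega)]
    refine separated_of_perm (List.Perm.swap _ _ _) (.refl _)
      (separated_triple (fold_linked h' (by omega) (by omega))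
        (fold_linked h' (by omega) (by omega)) (fold_linked h' (by omega) (by omega)) (p + 1)
        (fold_cut h' (by omega) (by omega)))

theorem fold_separated_top_small {t p : ℕ} (h : FoldParameters m δ e)
    (hp : p = 2 * m + δ + e) (hm : m = 1) (ht : t + 2 + p = 3 * m + δ + e + δ) :
    FoldSeparated m δ e t p (2 * m + δ) := by
  unfold FoldSeparated
  have h' := h
  obtain ⟨h1, h2, h3, h4, h5⟩ := h
  by_cases he : e = 1
  · rw [fold_last_x₂ h' (by omega) (by omega) (by omega), fold_loop h' (by omega) (by omega)]
    refine separated_of_perm (perm_rotate_right _ _ _) (.refl _)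
      (separated_triple (fold_linked h' (by omega) (by omega))
        (fold_linked h' (by omega) (by omega)) (fold_linked h' (by omega) (by omega)) (p + 1)
        (fold_cut h' (by omega) (by omega)))
  · rw [fold_last_anchor h' (by omega) (by omega) (by omega), fold_x₁ h' (by omega)]
    refine separated_of_perm (perm_rotate_right _ _ _) (.refl _)
      (separated_triple (fold_linked h' (by omega) (by omega))
        (fold_linked h' (by omega) (by omega)) (fold_linked h' (by omega) (by omega)) (p + 1)
        (fold_cut h' (by omega) (by omega)))

theorem fold_first {p : ℕ} (h : FoldParameters m δ e) (hp : p < 3 * m + δ + e + δ)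
    (ht : foldTime m δ e p = 1) :
    ((fold m δ e).pairNb p).length ≠ ((fold m δ e).pairNb (foldNext m δ e p)).length := by
  have h' := h
  obtain ⟨h1, h2, h3, h4, h5⟩ := h
  have hτ := foldTime_spec hp
  have hnx := foldNext_spec m δ e p
  have hp2 : ((fold m δ e).pairNb p).length = 2 := by
    by_cases hδ : δ = 0
    · rw [fold_last h' (by omega) hδ]
      rfl
    · rw [fold_single (by omega)]
      rfl
  have hq3 : ((fold m δ e).pairNb (foldNext m δ e p)).length = 3 := by
    by_cases hq : foldNext m δ e p = 0
    · rw [hq, fold_zero h']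
      rfl
    · rw [fold_loop h' (by omega) (by omega)]
      rfl
  omega

theorem fold_certificate (h : FoldParameters m δ e) :
    SplitCertificate (3 * m + δ + e + δ) (fold m δ e).pairNb (foldRank m δ e) (foldTime m δ e)
      (foldNext m δ e) (2 * m + δ + e - 1) := by
  refine SplitCertificate.of_separated ?_ h.rank_inj h.rank_le h.next_spec h.time_inj
    (fun p hp _ ht => fold_first h hp ht) ?_
  · have := h.pos
    omega
  · intro p hp hpz t ht
    have hτ := foldTime_spec hp
    have hnx := foldNext_spec m δ e p
    have h' := h
    obtain ⟨h1, h2, h3, h4, h5⟩ := h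
    by_cases c1 : p < m
    · rw [show foldNext m δ e p = 2 * m + δ - 1 - p by omega]
      by_cases c2 : p = 0
      · subst c2
        exact fold_separated_start h' (by omega)
      · by_cases c3 : p + 1 < m + δ
        · exact fold_separated_first h' (by omega) c3 c1 (by omega)
        · exact fold_separated_bottom h' (by omega) (by omega) (by omega)
    by_cases c2 : p < 2 * m + δ
    · rw [show foldNext m δ e p = 3 * m + δ + e - 1 + m + δ - p by omega]
      by_cases c3 : p = m
      · exact fold_separated_fold h' c3 (by omega)
      by_cases c4 : m + δ < p
      · by_cases c5 : p + 1 = 2 * m + δ ∧ e = 1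
        · exact fold_separated_second_top h' c4 c5 (by omega)
        · exact fold_separated_second h' c4 (by omega) (by omega)
      · by_cases c5 : 3 ≤ m + e
        · exact fold_separated_second_last h' (by omega) (by omega) c5 (by omega)
        · exact fold_separated_second_small h' (by omega) (by omega) (by omega) (by omega)
    by_cases c3 : p < 2 * m + δ + e
    · rw [show foldNext m δ e p = p + 1 by omega]
      exact fold_separated_middle h' (by omega) (by omega) (by omega)
    by_cases c4 : p = 2 * m + δ + e
    · rw [show foldNext m δ e p = 2 * m + δ by omega]
      by_cases c5 : 2 ≤ m
      · exact fold_separated_top h' c4 c5 (by omega)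
      · exact fold_separated_top_small h' c4 (by omega) (by omega)
    · rw [show foldNext m δ e p = p + m - 1 - (3 * m + δ + e) by omega]
      by_cases c5 : p + 1 = 3 * m + δ + e
      · exact fold_separated_third_last h' (by omega) c5 (by omega) (by omega)
      by_cases c6 : 3 * m + δ + e + 1 = p + m
      · rw [show p + m - 1 - (3 * m + δ + e) = 0 by omega]
        exact fold_separated_third_start h' (by omega) c6 (by omega)
      · exact fold_separated_third h' (by omega) (by omega) (by omega)

theorem length_pairNb_fold (h : FoldParameters m δ e) {p : ℕ} (hp : p < 3 * m + δ + e + δ) :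
    ((fold m δ e).pairNb p).length = 2 ∨ ((fold m δ e).pairNb p).length = 3 := by
  have h' := h
  obtain ⟨h1, h2, h3, h4, h5⟩ := h
  by_cases c1 : p = 3 * m + δ + e
  · rw [fold_single c1]
    exact Or.inl rfl
  by_cases c2 : p = 0
  · rw [c2, fold_zero h']
    exact Or.inr rfl
  by_cases c3 : p + 1 = 3 * m + δ + e
  · by_cases hδ : δ = 0
    · rw [fold_last h' c3 hδ]
      exact Or.inl rfl
    by_cases c4 : 3 ≤ m + e
    · rw [fold_last_anchor h' c3 (by omega) c4]
      exact Or.inr rfl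
    · rw [fold_last_x₂ h' c3 (by omega) (by omega)]
      exact Or.inr rfl
  by_cases c4 : p = 2 * m + δ - 2 + e
  · rw [fold_x₁ h' c4]
    exact Or.inr rfl
  by_cases c5 : p = 2 * m + δ + 1
  · rw [fold_x₂ h' c5 (by omega)]
    exact Or.inr rfl
  by_cases c6 : p = m ∨ p + 1 = m + δ
  · rw [fold_plain h' (by omega) c6]
    exact Or.inl rfl
  · rw [fold_loop h' (by omega) (by omega)]
    exact Or.inr rfl

theorem existsLongRefinementTwoThree_fold (h : FoldParameters m δ e) :
    ExistsLongRefinementTwoThree (2 * (3 * m + δ + e) + δ) := by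
  refine existsLongRefinementTwoThree (D := fold m δ e) h.valid (fold_certificate h) ?_ ?_
    (fun p hp => length_pairNb_fold h hp) ⟨m, ?_, ?_⟩
  · obtain ⟨h1, h2, h3, h4, h5⟩ := h
    simp only [fold]
    omega
  · have h' := h
    obtain ⟨h1, h2, h3, h4, h5⟩ := h
    exact fold_linked h' (by simp only [fold]; omega) (by simp only [fold]; omega)
  · have := h.pos
    simp only [fold]
    omega
  · have := h.pos
    have := h.one_le
    rw [fold_plain h (by omega) (Or.inl rfl)]
    rfl

end Fold

/-! ### The family `weave`: residues 0 and 15 modulo 18 -/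

/-- Three arms with loops at two of three consecutive levels. If `δ = 0`, then the first arm is
longer than the others, if `δ = 1`, then a pair lies between the second and the third arm, and the
single vertex is adjacent to this pair. -/
def weave (k δ : ℕ) : PairString where
  len := 9 * k + 9 - 2 * δ
  single := δ
  x₁ := 6 * k + 6 - 3 * δ
  x₂ := 6 * k + 7 - 2 * δ
  anchor := 6 * k + 7 - 3 * δ
  -- The residues say that the level is not divisible by three. The last clause is the end of the
  -- third arm, where the loop makes up for the missing next pair, so that level zero has degree two
  -- throughout.
  loop p := (p = 2 ∧ δ = 0) ∨
    (2 * (1 - δ) < p ∧ p < 3 * k + 5 - 3 * δ ∧ p % 3 ≠ 1) ∨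
    (3 * k + 5 - 3 * δ ≤ p ∧ p < 6 * k + 6 - 3 * δ ∧ p % 3 ≠ 2) ∨
    (6 * k + 7 - 2 * δ < p ∧ (p + 2 * δ) % 3 ≠ 2) ∨ p + 1 + 2 * δ = 9 * k + 9
  decLoop _ := inferInstance

/-- The level of a node in the quotient of `weave`. -/
def weaveLevel (k δ p : ℕ) : ℕ :=
  if δ = 0 ∧ p = 0 then 3 * k + 2
  else if p + 3 * δ ≤ 3 * k + 4 then 3 * k + 4 - 3 * δ - p
  else if p + 3 * δ ≤ 6 * k + 6 then p + 3 * δ - 3 * k - 5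
  else if δ = 1 ∧ p = 6 * k + 4 then 3 * k + 2
  else if p + 2 * δ < 9 * k + 9 then 9 * k + 8 - 2 * δ - p
  else 3 * k + 3

/-- The position of a node in the quotient of `weave` within its level. -/
def weaveArm (k δ p : ℕ) : ℕ :=
  if δ = 0 ∧ p = 0 then 2
  else if δ = 0 ∧ p = 2 then 1
  else if p + 3 * δ ≤ 3 * k + 4 then 0
  else if p + 3 * δ ≤ 6 * k + 6 then 1
  else if p + 2 * δ < 9 * k + 9 then 2
  else 0

/-- The node `p` in the quotient of `weave` has level `b` and position `a`. -/
abbrev WeaveAt (k δ p b a : ℕ) : Prop :=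
  (b ≤ 3 * k + 1 ∧ ((a = 0 ∧ p + b + 3 * δ = 3 * k + 4) ∨ (a = 1 ∧ p + 3 * δ = 3 * k + 5 + b) ∨
    (a = 2 ∧ p + b + 1 + 2 * δ = 9 * k + 9))) ∨
  (b = 3 * k + 3 ∧ a = 0 ∧ ((δ = 0 ∧ p = 1) ∨ (δ = 1 ∧ p = 9 * k + 7))) ∨
  (b = 3 * k + 2 ∧ a = 2 ∧ ((δ = 0 ∧ p = 0) ∨ (δ = 1 ∧ p = 6 * k + 4))) ∨
  (b = 3 * k + 2 ∧ a = 1 ∧ δ = 0 ∧ p = 2)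

/-- The rank in the quotient of `weave`: first the levels divisible by three, then the others in
reverse order. -/
def weaveRank (k δ p : ℕ) : ℕ :=
  if weaveLevel k δ p % 3 = 0 then weaveLevel k δ p + weaveArm k δ p
  else if weaveLevel k δ p % 3 = 1 then 9 * k + 8 - δ + weaveArm k δ p - 2 * weaveLevel k δ p
  else 9 * k + 7 - δ + weaveArm k δ p - 2 * weaveLevel k δ p

/-- The times of the cuts in the quotient of `weave`: first the levels are separated, then the
nodes within the levels in the order of the string. -/
def weaveTime (k δ p : ℕ) : ℕ :=
  if weaveLevel k δ p = 3 * k + 3 then 1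
  else if weaveArm k δ p = 2 then
    -- The order of the level cuts is a relay: time `3j + 2` cuts level `3j` from the higher
    -- multiples of three; this separates level `3j + 2` from `3j + 1` at time `3j + 3`, then `3j +
    -- 4` from `3j + 2` at time `3j + 4`, and then level `3j + 3` from the higher multiples of three
    -- at time `3j + 5`.
    weaveLevel k δ p + if weaveLevel k δ p % 3 = 0 then 2 else weaveLevel k δ p % 3 - 1
  else p + 3 * k + 2 + 2 * δ

/-- The node of level `b` and position `a`. -/
def weavePos (k δ b a : ℕ) : ℕ :=
  if b ≤ 3 * k + 1 then
    if a = 0 then 3 * k + 4 - 3 * δ - b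
    else if a = 1 then 3 * k + 5 + b - 3 * δ else 9 * k + 8 - 2 * δ - b
  else if b = 3 * k + 3 then if δ = 0 then 1 else 9 * k + 7
  else if δ = 1 then 6 * k + 4
  else if a = 2 then 0 else 2

/-- The successor of the node of level `b` and position `a` with respect to `weaveRank`. -/
def weaveSucc (k δ b a : ℕ) : ℕ :=
  if b = 3 * k + 3 then weavePos k δ (3 * k + 2) (1 + δ)
  else if a < 2 then weavePos k δ b (a + 1)
  else if b % 3 = 0 then weavePos k δ (b + 3) 0
  else weavePos k δ (b + b % 3 - 3) 0

/-- The successor with respect to `weaveRank`. -/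
def weaveNext (k δ p : ℕ) : ℕ :=
  weaveSucc k δ (weaveLevel k δ p) (weaveArm k δ p)

section Weave

variable {k δ p q a b : ℕ}

theorem weaveAt (hδ : δ ≤ 1) (hp : p + δ < 9 * k + 9) :
    WeaveAt k δ p (weaveLevel k δ p) (weaveArm k δ p) := by
  unfold weaveLevel weaveArm
  by_cases c1 : δ = 0 ∧ p = 0
  · rw [if_pos c1, if_pos c1]
    exact Or.inr (Or.inr (Or.inl ⟨rfl, rfl, Or.inl c1⟩))
  rw [if_neg c1, if_neg c1]
  by_cases c2 : p + 3 * δ ≤ 3 * k + 4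
  · rw [if_pos c2, if_pos c2]
    by_cases c3 : δ = 0 ∧ p = 2
    · rw [if_pos c3]
      exact Or.inr (Or.inr (Or.inr ⟨by omega, rfl, c3⟩))
    rw [if_neg c3]
    by_cases c4 : δ = 0 ∧ p = 1
    · exact Or.inr (Or.inl ⟨by omega, rfl, Or.inl c4⟩)
    · exact Or.inl ⟨by omega, Or.inl ⟨rfl, by omega⟩⟩
  rw [if_neg c2, if_neg c2, if_neg (by omega : ¬ (δ = 0 ∧ p = 2))]
  by_cases c3 : p + 3 * δ ≤ 6 * k + 6
  · rw [if_pos c3, if_pos c3]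
    exact Or.inl ⟨by omega, Or.inr (Or.inl ⟨rfl, by omega⟩)⟩
  rw [if_neg c3, if_neg c3]
  by_cases c4 : δ = 1 ∧ p = 6 * k + 4
  · rw [if_pos c4, if_pos (by omega)]
    exact Or.inr (Or.inr (Or.inl ⟨rfl, rfl, Or.inr c4⟩))
  rw [if_neg c4]
  by_cases c5 : p + 2 * δ < 9 * k + 9
  · rw [if_pos c5, if_pos c5]
    exact Or.inl ⟨by omega, Or.inr (Or.inr ⟨rfl, by omega⟩)⟩
  · rw [if_neg c5, if_neg c5]
    exact Or.inr (Or.inl ⟨rfl, rfl, Or.inr (by omega)⟩)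

theorem WeaveAt.unique {a' b' : ℕ} (hδ : δ ≤ 1) (h : WeaveAt k δ p b a)
    (h' : WeaveAt k δ p b' a') : b = b' ∧ a = a' := by
  omega

theorem WeaveAt.lt (hδ : δ ≤ 1) (h : WeaveAt k δ p b a) : p + δ < 9 * k + 9 := by
  omega

theorem WeaveAt.level_eq (hδ : δ ≤ 1) (h : WeaveAt k δ p b a) :
    weaveLevel k δ p = b ∧ weaveArm k δ p = a :=
  (weaveAt hδ (h.lt hδ)).unique hδ h

theorem WeaveAt.bound (hδ : δ ≤ 1) (h : WeaveAt k δ p b a) :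
    (b = 3 * k + 3 ∧ a = 0) ∨ (b = 3 * k + 2 ∧ 1 + δ ≤ a ∧ a ≤ 2) ∨ (b ≤ 3 * k + 1 ∧ a ≤ 2) := by
  omega

theorem WeaveAt.rank_spec (hδ : δ ≤ 1) (h : WeaveAt k δ p b a) :
    (b % 3 = 0 ∧ weaveRank k δ p = b + a) ∨
    (b % 3 = 1 ∧ weaveRank k δ p + 2 * b + δ = 9 * k + 8 + a) ∨
    (b % 3 = 2 ∧ weaveRank k δ p + 2 * b + δ = 9 * k + 7 + a) := by
  unfold weaveRank
  rw [(h.level_eq hδ).1, (h.level_eq hδ).2]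
  split_ifs <;> omega

theorem WeaveAt.time_spec (hδ : δ ≤ 1) (h : WeaveAt k δ p b a) :
    (b = 3 * k + 3 ∧ weaveTime k δ p = 1) ∨
    (a = 2 ∧ b % 3 = 0 ∧ weaveTime k δ p = b + 2) ∨
    (a = 2 ∧ b % 3 = 1 ∧ weaveTime k δ p = b) ∨
    (a = 2 ∧ b % 3 = 2 ∧ weaveTime k δ p = b + 1) ∨
    (a < 2 ∧ b < 3 * k + 3 ∧ weaveTime k δ p = p + 3 * k + 2 + 2 * δ) := by
  have hb := h.bound hδ
  unfold weaveTime
  rw [(h.level_eq hδ).1, (h.level_eq hδ).2]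
  clear h
  split_ifs with c1 c2 c3
  · exact Or.inl ⟨c1, rfl⟩
  · exact Or.inr (Or.inl ⟨c2, c3, rfl⟩)
  · by_cases c4 : b % 3 = 1
    · exact Or.inr (Or.inr (Or.inl ⟨c2, c4, by omega⟩))
    · exact Or.inr (Or.inr (Or.inr (Or.inl ⟨c2, by omega, by omega⟩)))
  · exact Or.inr (Or.inr (Or.inr (Or.inr ⟨by omega, by omega, rfl⟩)))

theorem weavePos_at (hδ : δ ≤ 1) (h : (b = 3 * k + 3 ∧ a = 0) ∨
    (b = 3 * k + 2 ∧ 1 + δ ≤ a ∧ a ≤ 2) ∨ (b ≤ 3 * k + 1 ∧ a ≤ 2)) :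
    WeaveAt k δ (weavePos k δ b a) b a := by
  unfold weavePos
  rcases h with ⟨rfl, rfl⟩ | ⟨rfl, h1, h2⟩ | ⟨h1, h2⟩
  · rw [if_neg (by omega), if_pos rfl]
    refine Or.inr (Or.inl ⟨rfl, rfl, ?_⟩)
    split_ifs with h0 <;> omega
  · rw [if_neg (by omega), if_neg (by omega)]
    by_cases c1 : δ = 1
    · rw [if_pos c1]
      exact Or.inr (Or.inr (Or.inl ⟨rfl, by omega, Or.inr ⟨c1, rfl⟩⟩))
    rw [if_neg c1]
    by_cases c2 : a = 2
    · rw [if_pos c2]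
      exact Or.inr (Or.inr (Or.inl ⟨rfl, c2, Or.inl ⟨by omega, rfl⟩⟩))
    · rw [if_neg c2]
      exact Or.inr (Or.inr (Or.inr ⟨rfl, by omega, by omega, rfl⟩))
  · rw [if_pos h1]
    refine Or.inl ⟨h1, ?_⟩
    split_ifs <;> omega

theorem WeaveAt.next_eq (hδ : δ ≤ 1) (h : WeaveAt k δ p b a) :
    weaveNext k δ p = weaveSucc k δ b a := by
  unfold weaveNext
  rw [(h.level_eq hδ).1, (h.level_eq hδ).2]

/-- Coordinates of the successor. -/
theorem WeaveAt.next_at (hδ : δ ≤ 1) (h : WeaveAt k δ p b a)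
    (hz : p + 2 + 2 * δ ≠ 9 * k + 9) : ∃ b' a', WeaveAt k δ (weaveNext k δ p) b' a' ∧
      ((b = 3 * k + 3 ∧ b' = 3 * k + 2 ∧ a' = 1 + δ) ∨
      (b ≤ 3 * k + 2 ∧ a < 2 ∧ b' = b ∧ a' = a + 1) ∨
      (b ≤ 3 * k ∧ a = 2 ∧ b % 3 = 0 ∧ b' = b + 3 ∧ a' = 0) ∨
      (b ≤ 3 * k + 1 ∧ a = 2 ∧ b % 3 = 1 ∧ b' + 2 = b ∧ a' = 0) ∨
      (b ≤ 3 * k + 2 ∧ a = 2 ∧ b % 3 = 2 ∧ b' + 1 = b ∧ a' = 0)) := by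
  have hb := h.bound hδ
  rw [h.next_eq hδ]
  unfold weaveSucc
  by_cases c1 : b = 3 * k + 3
  · rw [if_pos c1]
    exact ⟨_, _, weavePos_at hδ (by omega), Or.inl ⟨c1, rfl, rfl⟩⟩
  rw [if_neg c1]
  by_cases c2 : a < 2
  · rw [if_pos c2]
    exact ⟨_, _, weavePos_at hδ (by omega), Or.inr (Or.inl ⟨by omega, c2, rfl, rfl⟩)⟩
  rw [if_neg c2]
  by_cases c3 : b % 3 = 0
  · rw [if_pos c3]
    exact ⟨_, _, weavePos_at hδ (by omega),
      Or.inr (Or.inr (Or.inl ⟨by omega, by omega, c3, rfl, rfl⟩))⟩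
  · rw [if_neg c3]
    refine ⟨_, _, weavePos_at hδ (by omega), Or.inr (Or.inr (Or.inr ?_))⟩
    by_cases c4 : b % 3 = 1
    · exact Or.inl ⟨by omega, by omega, c4, by omega, rfl⟩
    · exact Or.inr ⟨by omega, by omega, by omega, by omega, rfl⟩

/-- Cuts between levels are late for high levels. -/
theorem WeaveAt.linked_level {a' b' t : ℕ} (hδ : δ ≤ 1) (hp : WeaveAt k δ p b a)
    (hq : WeaveAt k δ q b' a') (hb : b % 3 = 0 ↔ b' % 3 = 0) (ht : t ≤ 3 * k + 2)
    (hbt : b = b' ∨ (t < b + 2 ∧ t < b' + 2)) :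
    Linked (9 * k + 9 - δ) (weaveRank k δ) (weaveTime k δ) t p q := by
  intro x hx h1 h2
  have hX := weaveAt (k := k) (p := x) hδ (by omega)
  generalize weaveLevel k δ x = c at hX
  generalize weaveArm k δ x = d at hX
  have hT := hX.time_spec hδ
  have hR := hX.rank_spec hδ
  have hB := hX.bound hδ
  have hp1 := hp.rank_spec hδ
  have hp2 := hp.bound hδ
  have hq1 := hq.rank_spec hδ
  have hq2 := hq.bound hδ
  -- Cuts inside levels belong to the second phase and are too late to matter.
  have hD : d < 2 → c < 3 * k + 3 → 3 * k + 2 < weaveTime k δ x := by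
    clear hR hp1 hp2 hq1 hq2 hp hq h1 h2
    omega
  clear hX hp hq
  generalize weaveTime k δ x = tx at *
  generalize weaveRank k δ x = rx at *
  generalize weaveRank k δ p = rp at *
  generalize weaveRank k δ q = rq at *
  have h3 : (rp ≤ rx ∧ rx < rq) ∨ (rq ≤ rx ∧ rx < rp) := by omega
  clear h1 h2
  by_contra hlt
  by_cases hb0 : b % 3 = 0
  · have hb0' := hb.1 hb0
    have hp1 : rp = b + a := by omega
    have hq1 : rq = b' + a' := by omega
    rcases hT with hT | hT | hT | hT | hT <;> omega
  · have hb0' : b' % 3 ≠ 0 := mt hb.2 hb0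
    rcases hT with hT | hT | hT | hT | hT <;> rcases hp1 with hp1 | hp1 | hp1 <;>
      rcases hq1 with hq1 | hq1 | hq1 <;> omega

/-- Cuts within a level. -/
theorem WeaveAt.linked_arm {a' t : ℕ} (hδ : δ ≤ 1) (hp : WeaveAt k δ p b a)
    (hq : WeaveAt k δ q b a') (hb : b ≤ 3 * k + 1 ∨ (b = 3 * k + 2 ∧ t < 3 * k + 4))
    (ht : (0 < a ∧ 0 < a') ∨ t + b + δ < 6 * k + 6) (ht' : t + δ < 6 * k + 7 + b) :
    Linked (9 * k + 9 - δ) (weaveRank k δ) (weaveTime k δ) t p q := by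
  intro x hx h1 h2
  have hX := weaveAt (k := k) (p := x) hδ (by omega)
  generalize weaveLevel k δ x = c at hX
  generalize weaveArm k δ x = d at hX
  have hT := hX.time_spec hδ
  have hR := hX.rank_spec hδ
  have hB := hX.bound hδ
  have hp1 := hp.rank_spec hδ
  have hp2 := hp.bound hδ
  have hq1 := hq.rank_spec hδ
  have hq2 := hq.bound hδ
  clear hp hq
  generalize weaveTime k δ x = tx at *
  generalize weaveRank k δ x = rx at *
  generalize weaveRank k δ p = rp at *
  generalize weaveRank k δ q = rq at *
  have h3 : (rp ≤ rx ∧ rx < rq) ∨ (rq ≤ rx ∧ rx < rp) := by omega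
  clear h1 h2
  have h4 : c = b := by
    clear hX hT
    rcases hR with hR | hR | hR <;> rcases hp1 with hp1 | hp1 | hp1 <;> omega
  subst h4
  have h5 : (a ≤ d ∧ d < a') ∨ (a' ≤ d ∧ d < a) := by
    clear hX hT
    omega
  have h6 : tx = x + 3 * k + 2 + 2 * δ := by
    clear hX hR hp1 hq1 h3
    omega
  clear hR hT hp1 hq1 h3
  omega

/-- A cut of a given time between two given nodes. -/
theorem WeaveAt.cut {x c d t p' b' a' : ℕ} (hδ : δ ≤ 1) (hx : WeaveAt k δ x c d)
    (hp : WeaveAt k δ p b a) (hp' : WeaveAt k δ p' b' a')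
    (H : (b % 3 = 0 ∧ b' % 3 ≠ 0 ∧ c = 3 * k + 3 ∧ t = 1) ∨
      (b % 3 = 0 ∧ b' % 3 = 0 ∧ c % 3 = 0 ∧ d = 2 ∧ b ≤ c ∧ c < b' ∧ t = c + 2) ∨
      (b % 3 ≠ 0 ∧ b' % 3 ≠ 0 ∧ c % 3 = 1 ∧ 1 < c ∧ d = 2 ∧ c ≤ b ∧ b' < c ∧ t = c) ∨
      (b % 3 ≠ 0 ∧ b' % 3 ≠ 0 ∧ c % 3 = 2 ∧ d = 2 ∧ c ≤ b ∧ b' < c ∧ t = c + 1) ∨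
      (b = c ∧ b' = c ∧ c ≤ 3 * k + 2 ∧ a ≤ d ∧ d < a' ∧ t = x + 3 * k + 2 + 2 * δ)) :
    x < 9 * k + 9 - δ ∧ x ≠ 9 * k + 7 - 2 * δ ∧ weaveTime k δ x = t ∧
      ((weaveRank k δ p ≤ weaveRank k δ x ∧ weaveRank k δ x < weaveRank k δ p') ∨
        (weaveRank k δ p' ≤ weaveRank k δ x ∧ weaveRank k δ x < weaveRank k δ p)) := by
  have hT := hx.time_spec hδ
  have hR := hx.rank_spec hδ
  have hB := hx.bound hδ
  have hp1 := hp.rank_spec hδ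
  have hp2 := hp.bound hδ
  have hq1 := hp'.rank_spec hδ
  have hq2 := hp'.bound hδ
  clear hp hp'
  generalize weaveTime k δ x = tx at *
  generalize weaveRank k δ x = rx at *
  generalize weaveRank k δ p = rp at *
  generalize weaveRank k δ p' = rq at *
  have h1 : x < 9 * k + 9 - δ ∧ x ≠ 9 * k + 7 - 2 * δ := by
    clear hT hR hp1 hq1 hp2
    rcases H with H | H | H | H | H <;> omega
  refine ⟨h1.1, h1.2, ?_, Or.inl ?_⟩
  · clear hR hp1 hq1 hx
    rcases H with H | H | H | H | H <;> omega
  · clear hx hT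
    rcases H with H | H | H | H | H
    · omega
    · omega
    · rcases hp1 with hp1 | hp1 | hp1 <;> rcases hq1 with hq1 | hq1 | hq1 <;> omega
    · rcases hp1 with hp1 | hp1 | hp1 <;> rcases hq1 with hq1 | hq1 | hq1 <;> omega
    · omega

theorem weave_valid (hδ : δ ≤ 1) : (weave k δ).Valid := by
  constructor <;> (try simp only [weave]) <;> omega

theorem weave_zero (hδ : δ ≤ 1) :
    (weave k δ).pairNb 0 = [1, 6 * k + 6 - 3 * δ, 6 * k + 6 - 3 * δ] :=
  pairNb_zero (by simp only [weave]; omega)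

theorem weave_loop (hδ : δ ≤ 1) (h : WeaveAt k δ p b a) (hp : 0 < p)
    (hb : (b ≤ 3 * k + 1 ∧ b % 3 ≠ 0 ∧ (b ≤ 3 * k ∨ a = 0)) ∨ (b = 3 * k + 2 ∧ a = 1)) :
    (weave k δ).pairNb p = [p - 1, p + 1, p] := by
  apply pairNb_loop <;> (try simp only [weave]) <;> omega

theorem weave_plain (hδ : δ ≤ 1) (h : WeaveAt k δ p b a) (hb : b % 3 = 0)
    (hb' : 0 < b ∨ a < 2) (hp : p + 2 * δ < 9 * k + 9) :
    (weave k δ).pairNb p = [p - 1, p + 1] := by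
  apply pairNb_plain <;> (try simp only [weave]) <;> omega

theorem weave_x₁ (hδ : δ ≤ 1) (hp : p + 3 * δ = 6 * k + 6) :
    (weave k δ).pairNb p = [p - 1, p + 1, 0] := by
  apply pairNb_x₁ <;> (try simp only [weave]) <;> omega

theorem weave_x₂ (hδ : δ ≤ 1) (hp : p + 2 * δ = 6 * k + 7) :
    (weave k δ).pairNb p = [p - 1, p + 1, 0] := by
  apply pairNb_x₂ <;> (try simp only [weave]) <;> omega

theorem weave_middle (hδ : δ = 1) (hp : p = 6 * k + 4) :
    (weave k δ).pairNb p = [p - 1, p + 1, 9 * k + 7] := by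
  subst hδ
  refine pairNb_anchor ?_ ?_ ?_ ?_ ?_ ⟨rfl, ?_⟩ <;> (try simp only [weave]) <;> omega

theorem weave_last (hδ : δ ≤ 1) (hp : p + 1 + 2 * δ = 9 * k + 9) :
    (weave k δ).pairNb p = [p - 1, p] := by
  apply pairNb_last <;> (try simp only [weave]) <;> omega

theorem weave_single (hδ : δ = 1) (hp : p = 9 * k + 7) :
    (weave k δ).pairNb p = [6 * k + 4, 6 * k + 4] := by
  subst hδ hp
  exact pairNb_len

theorem weave_rank_inj (hδ : δ ≤ 1) : ∀ p < 9 * k + 9 - δ, ∀ q < 9 * k + 9 - δ,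
    weaveRank k δ p = weaveRank k δ q → p = q := by
  intro p hp q hq h
  have hP := weaveAt (k := k) (p := p) hδ (by omega)
  have hQ := weaveAt (k := k) (p := q) hδ (by omega)
  generalize weaveLevel k δ p = b at hP
  generalize weaveArm k δ p = a at hP
  generalize weaveLevel k δ q = b' at hQ
  generalize weaveArm k δ q = a' at hQ
  have hba : b = b' ∧ a = a' := by
    have hP1 := hP.rank_spec hδ
    have hP2 := hP.bound hδ
    have hQ1 := hQ.rank_spec hδ
    have hQ2 := hQ.bound hδ
    clear hP hQ hp hq
    rcases hP1 with hP1 | hP1 | hP1 <;> rcases hQ1 with hQ1 | hQ1 | hQ1 <;> omega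
  obtain ⟨rfl, rfl⟩ := hba
  omega

theorem weave_rank_le (hδ : δ ≤ 1) : ∀ p < 9 * k + 9 - δ,
    weaveRank k δ p ≤ weaveRank k δ (9 * k + 7 - 2 * δ) := by
  intro p hp
  have hP := weaveAt (k := k) (p := p) hδ (by omega)
  have hQ : WeaveAt k δ (9 * k + 7 - 2 * δ) 1 2 := by omega
  have := hP.rank_spec hδ
  have := hP.bound hδ
  have := hQ.rank_spec hδ
  clear hP hQ
  omega

theorem weave_next (hδ : δ ≤ 1) : ∀ p < 9 * k + 9 - δ, p ≠ 9 * k + 7 - 2 * δ →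
    weaveNext k δ p < 9 * k + 9 - δ ∧ weaveRank k δ (weaveNext k δ p) = weaveRank k δ p + 1 ∧
      0 < weaveTime k δ p ∧ weaveTime k δ p < 9 * k + 9 - δ := by
  intro p hp hpz
  have hP := weaveAt (k := k) (p := p) hδ (by omega)
  generalize weaveLevel k δ p = b at hP
  generalize weaveArm k δ p = a at hP
  obtain ⟨b', a', hQ, H⟩ := hP.next_at hδ (by omega)
  have hlt := hQ.lt hδ
  have hT := hP.time_spec hδ
  refine ⟨by clear hT hP hQ H; omega, ?_, ?_⟩
  · have hP1 := hP.rank_spec hδ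
    have hP2 := hP.bound hδ
    have hQ1 := hQ.rank_spec hδ
    clear hP hQ hT
    rcases H with H | H | H | H | H <;> omega
  · clear H hQ
    rcases hT with hT | hT | hT | hT | hT <;> omega

theorem weave_time_inj (hδ : δ ≤ 1) : ∀ p < 9 * k + 9 - δ, p ≠ 9 * k + 7 - 2 * δ →
    ∀ q < 9 * k + 9 - δ, q ≠ 9 * k + 7 - 2 * δ → weaveTime k δ p = weaveTime k δ q → p = q := by
  intro p hp hpz q hq hqz h
  have hP := weaveAt (k := k) (p := p) hδ (by omega)
  have hQ := weaveAt (k := k) (p := q) hδ (by omega)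
  generalize weaveLevel k δ p = b at hP
  generalize weaveArm k δ p = a at hP
  generalize weaveLevel k δ q = b' at hQ
  generalize weaveArm k δ q = a' at hQ
  have hP1 := hP.time_spec hδ
  have hQ1 := hQ.time_spec hδ
  have hP2 := hP.bound hδ
  have hQ2 := hQ.bound hδ
  rcases hP1 with hP1 | hP1 | hP1 | hP1 | hP1 <;>
    rcases hQ1 with hQ1 | hQ1 | hQ1 | hQ1 | hQ1 <;>
    first
    | (have hba : b = b' ∧ a = a' := by
        clear hP hQ hpz hqz
        omega
       obtain ⟨rfl, rfl⟩ := hba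
       clear hP2 hQ2 hP1 hQ1
       omega)
    | omega

theorem weave_first (hδ : δ ≤ 1) {p : ℕ} (hp : p < 9 * k + 9 - δ) (hpz : p ≠ 9 * k + 7 - 2 * δ)
    (ht : weaveTime k δ p = 1) :
    ((weave k δ).pairNb p).length ≠ ((weave k δ).pairNb (weaveNext k δ p)).length := by
  have hP := weaveAt (k := k) (p := p) hδ (by omega)
  generalize weaveLevel k δ p = b at hP
  generalize weaveArm k δ p = a at hP
  obtain ⟨b', a', hQ, H⟩ := hP.next_at hδ (by omega)
  have hT := hP.time_spec hδ
  have hb : b = 3 * k + 3 := by omega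
  have hb' : b' = 3 * k + 2 ∧ a' = 1 + δ := by omega
  clear H hT
  by_cases h0 : δ = 0
  · rw [weave_plain hδ hP (by omega) (by omega) (by omega),
      weave_loop hδ hQ (by omega) (by omega)]
    simp
  · rw [weave_single (by omega) (by omega), weave_middle (by omega) (by omega)]
    simp

end Weave

section Weave

variable {k δ t p q a b a' b' : ℕ}

/-- The condition of the certificate for two given lists of nodes of the quotient of `weave`. -/
abbrev WeaveSeparated (k δ t : ℕ) (L L' : List ℕ) : Prop :=
  Separated (9 * k + 9 - δ) (weaveRank k δ) (weaveTime k δ) (9 * k + 7 - 2 * δ) t L L'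

theorem weave_linked_zero (hδ : δ ≤ 1) :
    Linked (9 * k + 9 - δ) (weaveRank k δ) (weaveTime k δ) 0 p q := by
  intro x hx _ _
  have hX := weaveAt (k := k) (p := x) hδ (by omega)
  generalize weaveLevel k δ x = c at hX
  generalize weaveArm k δ x = d at hX
  have hT := hX.time_spec hδ
  rcases hT with hT | hT | hT | hT | hT <;> omega

/-- Neighbours of nodes of different levels divisible by three. -/
theorem weave_separated_even {u u' v v' d c' d' e' f' : ℕ} (hδ : δ ≤ 1)
    (hb : 0 < b) (hb3 : b % 3 = 0) (hbk : b ≤ 3 * k)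
    (hu : WeaveAt k δ u (b - 1) d) (hu' : WeaveAt k δ u' c' d') (hv : WeaveAt k δ v (b + 1) 2)
    (hv' : WeaveAt k δ v' e' f') (hc : c' % 3 ≠ 0 ∧ b + 1 ≤ c') (he : e' % 3 ≠ 0 ∧ b + 1 ≤ e') :
    WeaveSeparated k δ b [v, u] [v', u'] := by
  refine separated_of_perm (List.Perm.swap _ _ _) (List.Perm.swap _ _ _) (separated_pair
    (hv.linked_level hδ hv' (by clear hu hu' hv hv'; omega)
      (by clear hu hu' hv hv'; omega)
      (by clear hu hu' hv hv'; omega))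
    (hu.linked_level hδ hu' (by clear hu hu' hv hv'; omega)
      (by clear hu hu' hv hv'; omega)
      (by clear hu hu' hv hv'; omega)) v ?_)
  have := hv.cut (t := b + 1) hδ hu' hu
    (Or.inr (Or.inr (Or.inl (by clear hu hu' hv hv'; omega))))
  exact ⟨this.1, this.2.1, this.2.2.1, this.2.2.2.symm⟩

/-- Neighbours of the node of level one modulo three at the end of a level and of its successor. -/
theorem weave_separated_one {u u' v v' w w' x d d' e e' f f' ev ew : ℕ} (hδ : δ ≤ 1)
    (hb : 4 ≤ b) (hb3 : b % 3 = 1) (hbk : b ≤ 3 * k + 1) (ht : t + 2 = b)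
    (hu : WeaveAt k δ u (b - 1) d) (hu' : WeaveAt k δ u' (b - 1) d')
    (hv : WeaveAt k δ v ev e) (hev : b ≤ ev ∧ ev % 3 ≠ 0) (hv' : WeaveAt k δ v' (b - 3) e')
    (hw : WeaveAt k δ w ew f) (hew : b ≤ ew ∧ ew % 3 ≠ 0) (hw' : WeaveAt k δ w' (b - 2) f')
    (hx : WeaveAt k δ x (b - 2) 2) :
    WeaveSeparated k δ t [v, u, w] [v', u', w'] :=
  separated_triple (hu.linked_level hδ hu' (by clear hu hu' hv hv' hw hw' hx; omega)
      (by clear hu hu' hv hv' hw hw' hx; omega)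
      (by clear hu hu' hv hv' hw hw' hx; omega))
    (hw.linked_level hδ hw' (by clear hu hu' hv hv' hw hw' hx; omega)
      (by clear hu hu' hv hv' hw hw' hx; omega)
      (by clear hu hu' hv hv' hw hw' hx; omega))
    (hv.linked_level hδ hv' (by clear hu hu' hv hv' hw hw' hx; omega)
      (by clear hu hu' hv hv' hw hw' hx; omega)
      (by clear hu hu' hv hv' hw hw' hx; omega)) x (hx.cut hδ hv hv' (Or.inr (Or.inr (Or.inr (Or.inl
      (by clear hu hu' hv hv' hw hw' hx; omega))))))

/-- Neighbours of the node of level two modulo three at the end of a level and of its successor. -/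
theorem weave_separated_two {u u' v v' w w' x d d' e e' f f' eu ev ew ev' ew' : ℕ} (hδ : δ ≤ 1)
    (hb3 : b % 3 = 2) (hbk : b ≤ 3 * k + 2) (ht : t + 1 = b)
    (hu : WeaveAt k δ u eu d) (heu : eu = b + 1) (hu' : WeaveAt k δ u' (b - 2) d')
    (hv : WeaveAt k δ v ev e) (hev : b - 1 ≤ ev ∧ ev % 3 ≠ 0)
    (hv' : WeaveAt k δ v' ev' e') (hev' : b - 1 ≤ ev' ∧ ev' % 3 ≠ 0)
    (hw : WeaveAt k δ w ew f) (hew : b - 1 ≤ ew ∧ ew % 3 ≠ 0)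
    (hw' : WeaveAt k δ w' ew' f') (hew' : b - 1 ≤ ew' ∧ ew' % 3 ≠ 0)
    (hx : WeaveAt k δ x (b - 2) 2) :
    WeaveSeparated k δ t [u, v, w] [u', v', w'] := by
  refine separated_triple (hv.linked_level hδ hv' (by clear hu hu' hv hv' hw hw' hx; omega)
      (by clear hu hu' hv hv' hw hw' hx; omega)
      (by clear hu hu' hv hv' hw hw' hx; omega))
    (hw.linked_level hδ hw' (by clear hu hu' hv hv' hw hw' hx; omega)
      (by clear hu hu' hv hv' hw hw' hx; omega)
      (by clear hu hu' hv hv' hw hw' hx; omega))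
    (hu.linked_level hδ hu' (by clear hu hu' hv hv' hw hw' hx; omega)
      (by clear hu hu' hv hv' hw hw' hx; omega)
      (by clear hu hu' hv hv' hw hw' hx; omega)) x ?_
  have := hx.cut (t := t + 1) hδ hu' hu
    (Or.inr (Or.inl (by clear hu hu' hv hv' hw hw' hx; omega)))
  exact ⟨this.1, this.2.1, this.2.2.1, this.2.2.2.symm⟩

end Weave

section Weave

variable {k δ t p q a b a' b' : ℕ}

theorem weaveAt_zero (hb : b ≤ 3 * k + 1) (hp : p + b + 3 * δ = 3 * k + 4) :
    WeaveAt k δ p b 0 :=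
  Or.inl ⟨hb, Or.inl ⟨rfl, hp⟩⟩

theorem weaveAt_one (hb : b ≤ 3 * k + 1) (hp : p + 3 * δ = 3 * k + 5 + b) :
    WeaveAt k δ p b 1 :=
  Or.inl ⟨hb, Or.inr (Or.inl ⟨rfl, hp⟩)⟩

theorem weaveAt_two (hb : b ≤ 3 * k + 1) (hp : p + b + 1 + 2 * δ = 9 * k + 9) :
    WeaveAt k δ p b 2 :=
  Or.inl ⟨hb, Or.inr (Or.inr ⟨rfl, hp⟩)⟩

theorem pairNb_weave_even (hδ : δ ≤ 1) (hq : WeaveAt k δ q b 0) (hb : b % 3 = 0)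
    (hb' : 3 ≤ b) : ∃ u v c d e f, (weave k δ).pairNb q = [u, v] ∧ WeaveAt k δ u c d ∧
      WeaveAt k δ v e f ∧ (c % 3 ≠ 0 ∧ b ≤ c + 2) ∧ (e % 3 ≠ 0 ∧ b ≤ e + 2) := by
  by_cases c1 : b ≤ 3 * k
  · have hq' : q + b + 3 * δ = 3 * k + 4 := by omega
    rw [weave_plain hδ hq hb (Or.inl (by omega)) (by omega)]
    clear hq
    exact ⟨_, _, b + 1, 0, b - 1, 0, rfl, weaveAt_zero (by omega) (by omega),
      weaveAt_zero (by omega) (by omega), by omega, by omega⟩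
  · obtain rfl : b = 3 * k + 3 := by omega
    obtain rfl | rfl : δ = 0 ∨ δ = 1 := by omega
    · obtain rfl : q = 1 := by omega
      rw [weave_plain hδ hq hb (Or.inl (by omega)) (by omega)]
      clear hq
      exact ⟨_, _, 3 * k + 2, 2, 3 * k + 2, 1, rfl, by omega, by omega, by omega, by omega⟩
    · rw [weave_single rfl (by omega)]
      clear hq
      exact ⟨_, _, 3 * k + 2, 2, 3 * k + 2, 2, rfl, by omega, by omega, by omega, by omega⟩

/-- A node of level zero has a neighbour of degree two in its own level, whereas both neighbours of
the node of level three have degree three. The degree cut of the first round detects this. -/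
theorem weave_separated_last (hδ : δ ≤ 1) (hp : p + 1 + 2 * δ = 9 * k + 9)
    (hq : WeaveAt k δ q 3 0) :
    WeaveSeparated k δ 0 ((weave k δ).pairNb p) ((weave k δ).pairNb q) := by
  obtain ⟨u, v, c, d, e, f, h, hu, hv, hc, he⟩ := pairNb_weave_even hδ hq rfl le_rfl
  have hx := weavePos_at (k := k) (b := 3 * k + 3) (a := 0) hδ (Or.inl ⟨rfl, rfl⟩)
  rw [weave_last hδ hp, h]
  have hP : WeaveAt k δ p 0 2 := weaveAt_two (by omega) (by omega)
  have hP' : WeaveAt k δ (p - 1) 1 2 := weaveAt_two (by omega) (by omega)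
  exact separated_of_perm (List.Perm.swap _ _ _) (.refl _) (separated_pair
    (hP'.linked_level hδ hv (by clear hx hu hv hP hP' hq; omega)
        (by clear hx hu hv hP hP' hq; omega)
      (by clear hx hu hv hP hP' hq; omega))
    (weave_linked_zero hδ) _
    (hx.cut hδ hP hu (Or.inl (by clear hx hu hv hP hP' hq; omega))))

/-- The cut of time `b + 1` runs between the levels `b - 1` and `b + 1`. The node of level `b` has
one neighbour on each side, the node of level `b + 3` has none in level `b - 1` or below. -/
theorem weave_separated_zero_mod_three (hδ : δ ≤ 1) (hb : 0 < b) (hb3 : b % 3 = 0)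
    (hbk : b ≤ 3 * k) (hp : p + b + 1 + 2 * δ = 9 * k + 9) (hq : WeaveAt k δ q (b + 3) 0) :
    WeaveSeparated k δ b ((weave k δ).pairNb p) ((weave k δ).pairNb q) := by
  obtain ⟨u, v, c, d, e, f, h, hu, hv, hc, he⟩ := pairNb_weave_even hδ hq (by omega) (by omega)
  have hP : WeaveAt k δ p b 2 := weaveAt_two (by omega) (by omega)
  rw [weave_plain hδ hP hb3 (Or.inl hb) (by clear hP hu hv hq; omega), h]
  exact weave_separated_even hδ hb hb3 hbk
    (weaveAt_two (by omega) (by clear hP hu hv hq; omega)) hv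
    (weaveAt_two (by omega) (by clear hP hu hv hq; omega)) hu
    (by clear hP hu hv hq; omega) (by clear hP hu hv hq; omega)

/-- The cut of time `b - 1` runs between the levels `b - 3` and `b - 2`, and only the node of level
`b - 2` has a neighbour in level `b - 3`. -/
theorem weave_separated_one_mod_three (hδ : δ ≤ 1) (hb : 4 ≤ b) (hb3 : b % 3 = 1)
    (hbk : b ≤ 3 * k + 1) (hp : p + b + 1 + 2 * δ = 9 * k + 9)
    (hq : q + (b - 2) + 3 * δ = 3 * k + 4) (ht : t + 2 = b) :
    WeaveSeparated k δ t ((weave k δ).pairNb p) ((weave k δ).pairNb q) := by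
  rw [weave_loop (p := q) (b := b - 2) (a := 0) hδ (weaveAt_zero (by omega) (by omega))
    (by omega) (Or.inl (by omega))]
  refine separated_of_perm (K := (weave k δ).pairNb p) (.refl _) (List.Perm.swap _ _ _) ?_
  have hx := weavePos_at (k := k) (b := b - 2) (a := 2) hδ (Or.inr (Or.inr (by omega)))
  by_cases c1 : b ≤ 3 * k
  · rw [weave_loop (p := p) (b := b) (a := 2) hδ (weaveAt_two (by omega) (by omega))
      (by omega) (Or.inl (by omega))]
    exact weave_separated_one (ev := b + 1) (ew := b) hδ hb hb3 hbk ht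
      (weaveAt_two (by omega) (by omega)) (weaveAt_zero (by omega) (by omega))
      (weaveAt_two (by omega) (by omega)) (by omega) (weaveAt_zero (by omega) (by omega))
      (weaveAt_two (by omega) (by omega)) (by omega) (weaveAt_zero (by omega) (by omega)) hx
  · obtain rfl : b = 3 * k + 1 := by omega
    rw [weave_x₂ hδ (by omega)]
    obtain rfl | rfl : δ = 0 ∨ δ = 1 := by omega
    · exact weave_separated_one (ev := 3 * k + 1) (ew := 3 * k + 2) hδ hb hb3 hbk ht
        (weaveAt_two (by omega) (by omega)) (weaveAt_zero (by omega) (by omega))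
        (weaveAt_one (by omega) (by omega)) (by omega) (weaveAt_zero (by omega) (by omega))
        (Or.inr (Or.inr (Or.inl ⟨rfl, rfl, by omega⟩))) (by omega)
        (weaveAt_zero (by omega) (by omega)) hx
    · exact weave_separated_one (ev := 3 * k + 2) (ew := 3 * k + 1) hδ hb hb3 hbk ht
        (weaveAt_two (by omega) (by omega)) (weaveAt_zero (by omega) (by omega))
        (Or.inr (Or.inr (Or.inl ⟨rfl, rfl, by omega⟩))) (by omega)
        (weaveAt_zero (by omega) (by omega))
        (weaveAt_zero (by omega) (by omega)) (by omega) (weaveAt_zero (by omega) (by omega)) hx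

/-- The neighbours with level divisible by three are in the levels `b + 1` and `b - 2`,
respectively, and the cut of time `b` has just separated these. -/
theorem weave_separated_two_mod_three (hδ : δ ≤ 1) (hb3 : b % 3 = 2)
    (hbk : b ≤ 3 * k) (hp : p + b + 1 + 2 * δ = 9 * k + 9)
    (hq : q + (b - 1) + 3 * δ = 3 * k + 4) (ht : t + 1 = b) :
    WeaveSeparated k δ t ((weave k δ).pairNb p) ((weave k δ).pairNb q) := by
  have hx := weavePos_at (k := k) (b := b - 2) (a := 2) hδ (Or.inr (Or.inr (by omega)))
  rw [weave_loop (p := q) (b := b - 1) (a := 0) hδ (weaveAt_zero (by omega) (by omega))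
    (by omega) (Or.inl (by omega)), weave_loop (p := p) (b := b) (a := 2) hδ
    (weaveAt_two (by omega) (by omega)) (by omega) (Or.inl (by omega))]
  exact separated_of_perm (.refl _) (List.Perm.swap _ _ _)
    (weave_separated_two (ev := b - 1) (ew := b) (ev' := b) (ew' := b - 1) hδ hb3 (by omega) ht
      (weaveAt_two (by omega) (by omega)) rfl (weaveAt_zero (by omega) (by omega))
      (weaveAt_two (by omega) (by omega)) (by omega) (weaveAt_zero (by omega) (by omega)) (by omega)
      (weaveAt_two (by omega) (by omega)) (by omega) (weaveAt_zero (by omega) (by omega)) (by omega)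
      hx)

theorem weave_separated_top (hδ : δ ≤ 1) (hp : WeaveAt k δ p (3 * k + 2) 2)
    (hq : q + 3 * δ = 3) (ht : t = 3 * k + 1) :
    WeaveSeparated k δ t ((weave k δ).pairNb p) ((weave k δ).pairNb q) := by
  have hx := weavePos_at (k := k) (b := 3 * k + 2 - 2) (a := 2) hδ (Or.inr (Or.inr (by omega)))
  obtain rfl | rfl : δ = 0 ∨ δ = 1 := by omega
  · obtain rfl : p = 0 := by omega
    obtain rfl : q = 3 := by omega
    clear hp
    rw [weave_loop (p := 3) (b := 3 * k + 1) (a := 0) hδ (weaveAt_zero (by omega) (by omega))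
      (by omega) (Or.inl (by omega)), weave_zero hδ]
    exact separated_of_perm (.refl _) (List.Perm.swap _ _ _)
      (weave_separated_two (ev := 3 * k + 1) (ew := 3 * k + 1) (ev' := 3 * k + 2)
        (ew' := 3 * k + 1) hδ (b := 3 * k + 2) (by omega) le_rfl (by omega)
        (Or.inr (Or.inl ⟨rfl, rfl, by omega⟩)) rfl (weaveAt_zero (by omega) (by omega))
        (weaveAt_one (by omega) (by omega)) (by omega)
        (Or.inr (Or.inr (Or.inr ⟨rfl, rfl, rfl, rfl⟩))) (by omega)
        (weaveAt_one (by omega) (by omega)) (by omega)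
        (weaveAt_zero (by omega) (by omega)) (by omega) hx)
  · obtain rfl : p = 6 * k + 4 := by omega
    obtain rfl : q = 0 := by omega
    clear hp
    rw [weave_middle rfl rfl, weave_zero hδ]
    exact separated_of_perm (perm_rotate_right _ _ _) (.refl _)
      (weave_separated_two (ev := 3 * k + 1) (ew := 3 * k + 1) (ev' := 3 * k + 1)
        (ew' := 3 * k + 1) hδ (b := 3 * k + 2) (by omega) le_rfl (by omega)
        (Or.inr (Or.inl ⟨rfl, rfl, by omega⟩)) rfl (weaveAt_zero (by omega) (by omega))
        (weaveAt_one (by omega) (by omega)) (by omega)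
        (weaveAt_one (by omega) (by omega)) (by omega)
        (weaveAt_two (by omega) (by omega)) (by omega)
        (weaveAt_one (by omega) (by omega)) (by omega) hx)

end Weave

section Weave

variable {k δ t p q a b a' b' : ℕ}

/-- The cut between two nodes of the same level. -/
theorem WeaveAt.cut_arm {x d p' : ℕ} (hδ : δ ≤ 1) (hx : WeaveAt k δ x b d)
    (hp : WeaveAt k δ p b a) (hp' : WeaveAt k δ p' b a')
    (H : b ≤ 3 * k + 2 ∧ a ≤ d ∧ d < a' ∧ t = x + 3 * k + 2 + 2 * δ) :
    x < 9 * k + 9 - δ ∧ x ≠ 9 * k + 7 - 2 * δ ∧ weaveTime k δ x = t ∧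
      ((weaveRank k δ p ≤ weaveRank k δ x ∧ weaveRank k δ x < weaveRank k δ p') ∨
        (weaveRank k δ p' ≤ weaveRank k δ x ∧ weaveRank k δ x < weaveRank k δ p)) :=
  hx.cut hδ hp hp' (Or.inr (Or.inr (Or.inr (Or.inr ⟨rfl, rfl, H⟩))))

/-- The cut between the two highest of the levels that are not divisible by three. -/
theorem WeaveAt.cut_top {x p' : ℕ} (hδ : δ ≤ 1) (hx : WeaveAt k δ x (3 * k + 2) 2)
    (hp : WeaveAt k δ p (3 * k + 2) a) (hp' : WeaveAt k δ p' (3 * k + 1) a') :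
    x < 9 * k + 9 - δ ∧ x ≠ 9 * k + 7 - 2 * δ ∧ weaveTime k δ x = 3 * k + 3 ∧
      ((weaveRank k δ p ≤ weaveRank k δ x ∧ weaveRank k δ x < weaveRank k δ p') ∨
        (weaveRank k δ p' ≤ weaveRank k δ x ∧ weaveRank k δ x < weaveRank k δ p)) :=
  hx.cut hδ hp hp' (Or.inr (Or.inr (Or.inr (Or.inl (by clear hx hp hp'; omega)))))

/-- For `δ = 0` the second phase starts in level `3k + 2`: its cut from level `3k + 1` distinguishes
the loop at `2` from the double edge that leads from `0` to `x₁`. -/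
theorem weave_separated_second (ht : t = 3 * k + 2) :
    WeaveSeparated k 0 t ((weave k 0).pairNb 2) ((weave k 0).pairNb 0) := by
  subst ht
  rw [weave_loop (p := 2) (b := 3 * k + 2) (a := 1) (by omega)
    (Or.inr (Or.inr (Or.inr ⟨rfl, rfl, rfl, rfl⟩))) (by omega) (Or.inr ⟨rfl, rfl⟩),
    weave_zero (by omega)]
  have h2 : WeaveAt k 0 2 (3 * k + 2) 1 := Or.inr (Or.inr (Or.inr ⟨rfl, rfl, rfl, rfl⟩))
  have h0 : WeaveAt k 0 0 (3 * k + 2) 2 := Or.inr (Or.inr (Or.inl ⟨rfl, rfl, Or.inl ⟨rfl, rfl⟩⟩))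
  have hx : WeaveAt k 0 (6 * k + 6 - 3 * 0) (3 * k + 1) 1 := weaveAt_one le_rfl (by omega)
  have h3 : WeaveAt k 0 3 (3 * k + 1) 0 := weaveAt_zero le_rfl (by omega)
  have hn : (3 * k + 2) % 3 ≠ 0 ∧ (3 * k + 1) % 3 ≠ 0 := by omega
  exact separated_of_perm (perm_rotate_right _ _ _) (perm_rotate_right _ _ _)
    (separated_triple (Linked.refl _)
      (h3.linked_arm (by omega) hx (Or.inl le_rfl) (Or.inr (by clear h2 h0 hx h3; omega))
        (by clear h2 h0 hx h3; omega))
      (h2.linked_level (by omega) hx (iff_of_false hn.1 hn.2) le_rfl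
        (Or.inr (by clear h2 h0 hx h3; omega)))
      0 (h0.cut_top (by omega) h2 hx))

theorem weave_separated_third (ht : t = 3 * k + 3) :
    WeaveSeparated k 0 t ((weave k 0).pairNb 3) ((weave k 0).pairNb (6 * k + 6)) := by
  subst ht
  rw [weave_loop (p := 3) (b := 3 * k + 1) (a := 0) (by omega)
    (weaveAt_zero (by omega) (by omega)) (by omega) (Or.inl (by omega)),
    weave_x₁ (by omega) (by omega)]
  have h2 : WeaveAt k 0 2 (3 * k + 2) 1 := Or.inr (Or.inr (Or.inr ⟨rfl, rfl, rfl, rfl⟩))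
  have h0 : WeaveAt k 0 0 (3 * k + 2) 2 := Or.inr (Or.inr (Or.inl ⟨rfl, rfl, Or.inl ⟨rfl, rfl⟩⟩))
  refine separated_of_perm (.refl _) (perm_rotate_right _ _ _)
    (separated_triple
      ((weaveAt_zero (b := 3 * k) (by omega) (by omega)).linked_arm (by omega)
        (weaveAt_one (by omega) (by omega)) (Or.inl (by omega))
        (Or.inr (by clear h2 h0; omega)) (by clear h2 h0; omega))
      ((weaveAt_zero (b := 3 * k + 1) (by omega) (by omega)).linked_arm (by omega)
        (weaveAt_two (by omega) (by omega)) (Or.inl (by omega))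
        (Or.inr (by clear h2 h0; omega)) (by clear h2 h0; omega))
      (h2.linked_arm (by omega) h0 (Or.inr ⟨rfl, by clear h2 h0; omega⟩)
        (Or.inl (by clear h2 h0; omega)) (by clear h2 h0; omega)) 2
      (h2.cut_arm (by omega) h2 h0 (by clear h2 h0; omega)))

/-- For `δ = 1` the second phase starts in level `3k + 1`: the double edge from `0` to `x₁` stays in
this level, while one edge of `x₁` leads up to the middle pair. -/
theorem weave_separated_start (ht : t = 3 * k + 2) :
    WeaveSeparated k 1 t ((weave k 1).pairNb 0) ((weave k 1).pairNb (6 * k + 3)) := by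
  subst ht
  rw [weave_zero (by omega), weave_x₁ (by omega) (by omega)]
  have hm : WeaveAt k 1 (6 * k + 3 + 1) (3 * k + 2) 2 :=
    Or.inr (Or.inr (Or.inl ⟨rfl, rfl, Or.inr ⟨rfl, rfl⟩⟩))
  have hx : WeaveAt k 1 (6 * k + 6 - 3 * 1) (3 * k + 1) 1 := weaveAt_one le_rfl (by omega)
  have hn : (3 * k + 1) % 3 ≠ 0 ∧ (3 * k + 2) % 3 ≠ 0 := by omega
  have hc := hm.cut_top (by omega) hm hx
  refine separated_of_perm (List.Perm.swap _ _ _) (List.Perm.swap _ _ _)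
    (separated_triple
      ((weaveAt_zero (b := 3 * k) (by omega) (by omega)).linked_arm (by omega)
        (weaveAt_one (by omega) (by omega)) (Or.inl (by omega))
        (Or.inr (by clear hm hx; omega)) (by clear hm hx; omega))
      (hx.linked_arm (by omega) (weaveAt_zero (by omega) (by omega)) (Or.inl le_rfl)
        (Or.inr (by clear hm hx; omega)) (by clear hm hx; omega))
      (hx.linked_level (by omega) hm (iff_of_false hn.1 hn.2) le_rfl
        (Or.inr (by clear hm hx; omega))) _ ⟨hc.1, hc.2.1, hc.2.2.1, hc.2.2.2.symm⟩)

theorem weave_separated_first_arm (hδ : δ ≤ 1) (hb : 0 < b) (hbk : b ≤ 3 * k)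
    (hp : p + b + 3 * δ = 3 * k + 4) (hq : q + 3 * δ = 3 * k + 5 + b)
    (ht : t = p + 3 * k + 2 * δ) :
    WeaveSeparated k δ t ((weave k δ).pairNb p) ((weave k δ).pairNb q) := by
  have h₁ : Linked (9 * k + 9 - δ) (weaveRank k δ) (weaveTime k δ) (t + 1) (p + 1) (q - 1) :=
    (weaveAt_zero (b := b - 1) (by omega) (by omega)).linked_arm hδ
      (weaveAt_one (by omega) (by omega)) (Or.inl (by omega)) (Or.inr (by omega)) (by omega)
  have h₂ : Linked (9 * k + 9 - δ) (weaveRank k δ) (weaveTime k δ) (t + 1) p q :=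
    (weaveAt_zero (b := b) (by omega) (by omega)).linked_arm hδ
      (weaveAt_one (by omega) (by omega)) (Or.inl (by omega)) (Or.inr (by omega)) (by omega)
  have h₃ : Linked (9 * k + 9 - δ) (weaveRank k δ) (weaveTime k δ) t (p - 1) (q + 1) :=
    (weaveAt_zero (b := b + 1) (by omega) (by omega)).linked_arm hδ
      (weaveAt_one (by omega) (by omega)) (Or.inl (by omega)) (Or.inr (by omega)) (by omega)
  have hc := (weaveAt_zero (k := k) (δ := δ) (p := p - 1) (b := b + 1) (by omega)
    (by omega)).cut_arm (t := t + 1) hδ (weaveAt_zero (p := p - 1) (by omega) (by omega))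
    (weaveAt_one (p := q + 1) (by omega) (by omega)) (by omega)
  by_cases hb3 : b % 3 = 0
  · rw [weave_plain hδ (weaveAt_zero (p := p) (by omega) (by omega)) hb3 (Or.inl hb) (by omega),
      weave_plain hδ (weaveAt_one (p := q) (by omega) (by omega)) hb3 (Or.inl hb) (by omega)]
    exact separated_of_perm (.refl _) (List.Perm.swap _ _ _) (separated_pair h₁ h₃ _ hc)
  · rw [weave_loop hδ (weaveAt_zero (p := p) (b := b) (by omega) (by omega)) (by omega)
        (Or.inl (by omega)),
      weave_loop hδ (weaveAt_one (p := q) (b := b) (by omega) (by omega)) (by omega)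
        (Or.inl (by omega))]
    exact separated_of_perm (.refl _) (List.Perm.swap _ _ _) (separated_triple h₁ h₂ h₃ _ hc)

theorem weave_separated_first_turn (hδ : δ ≤ 1) (hp : p + 3 * δ = 3 * k + 4)
    (ht : t = p + 3 * k + 2 * δ) :
    WeaveSeparated k δ t ((weave k δ).pairNb p) ((weave k δ).pairNb (p + 1)) := by
  have h₁ : Linked (9 * k + 9 - δ) (weaveRank k δ) (weaveTime k δ) (t + 1) (p + 1) p :=
    (weaveAt_one (b := 0) (by omega) (by omega)).linked_arm hδ
      (weaveAt_zero (by omega) (by omega)) (Or.inl (by omega)) (Or.inr (by omega)) (by omega)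
  have h₃ : Linked (9 * k + 9 - δ) (weaveRank k δ) (weaveTime k δ) t (p - 1) (p + 1 + 1) :=
    (weaveAt_zero (b := 1) (by omega) (by omega)).linked_arm hδ
      (weaveAt_one (by omega) (by omega)) (Or.inl (by omega)) (Or.inr (by omega)) (by omega)
  have hc := (weaveAt_zero (k := k) (δ := δ) (p := p - 1) (b := 1) (by omega)
    (by omega)).cut_arm (t := t + 1) hδ (weaveAt_zero (p := p - 1) (by omega) (by omega))
    (weaveAt_one (p := p + 1 + 1) (by omega) (by omega)) (by omega)
  rw [weave_plain hδ (weaveAt_zero (p := p) (b := 0) (by omega) (by omega)) rfl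
      (Or.inr (by omega)) (by omega),
    weave_plain hδ (weaveAt_one (p := p + 1) (b := 0) (by omega) (by omega)) rfl
      (Or.inr (by omega)) (by omega)]
  exact separated_of_perm (.refl _) (List.Perm.swap _ _ _) (separated_pair h₁ h₃ _ hc)

theorem weave_separated_second_arm (hδ : δ ≤ 1) (hb : 0 < b) (hbk : b ≤ 3 * k)
    (hp : p + 3 * δ = 3 * k + 5 + b) (hq : q + b + 1 + 2 * δ = 9 * k + 9)
    (ht : t = p + 3 * k + 2 * δ) :
    WeaveSeparated k δ t ((weave k δ).pairNb p) ((weave k δ).pairNb q) := by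
  have h₁ : Linked (9 * k + 9 - δ) (weaveRank k δ) (weaveTime k δ) (t + 1) (p + 1) (q - 1) :=
    (weaveAt_one (b := b + 1) (by omega) (by omega)).linked_arm hδ
      (weaveAt_two (by omega) (by omega)) (Or.inl (by omega)) (Or.inl (by omega)) (by omega)
  have h₂ : Linked (9 * k + 9 - δ) (weaveRank k δ) (weaveTime k δ) (t + 1) p q :=
    (weaveAt_one (b := b) (by omega) (by omega)).linked_arm hδ
      (weaveAt_two (by omega) (by omega)) (Or.inl (by omega)) (Or.inl (by omega)) (by omega)
  have h₃ : Linked (9 * k + 9 - δ) (weaveRank k δ) (weaveTime k δ) t (p - 1) (q + 1) :=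
    (weaveAt_one (b := b - 1) (by omega) (by omega)).linked_arm hδ
      (weaveAt_two (by omega) (by omega)) (Or.inl (by omega)) (Or.inl (by omega)) (by omega)
  have hc := (weaveAt_one (k := k) (δ := δ) (p := p - 1) (b := b - 1) (by omega)
    (by omega)).cut_arm (t := t + 1) hδ (weaveAt_one (p := p - 1) (by omega) (by omega))
    (weaveAt_two (p := q + 1) (by omega) (by omega)) (by omega)
  by_cases hb3 : b % 3 = 0
  · rw [weave_plain hδ (weaveAt_one (p := p) (by omega) (by omega)) hb3 (Or.inl hb) (by omega),
      weave_plain hδ (weaveAt_two (p := q) (by omega) (by omega)) hb3 (Or.inl hb) (by omega)]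
    exact separated_of_perm (.refl _) (List.Perm.swap _ _ _) (separated_pair h₁ h₃ _ hc)
  · rw [weave_loop hδ (weaveAt_one (p := p) (b := b) (by omega) (by omega)) (by omega)
        (Or.inl (by omega)),
      weave_loop hδ (weaveAt_two (p := q) (b := b) (by omega) (by omega)) (by omega)
        (Or.inl (by omega))]
    exact separated_of_perm (.refl _) (List.Perm.swap _ _ _) (separated_triple h₁ h₂ h₃ _ hc)

theorem weave_separated_second_turn (hδ : δ ≤ 1) (hp : p + 3 * δ = 3 * k + 5)
    (hq : q + 1 + 2 * δ = 9 * k + 9) (ht : t = p + 3 * k + 2 * δ) :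
    WeaveSeparated k δ t ((weave k δ).pairNb p) ((weave k δ).pairNb q) := by
  have h₁ : Linked (9 * k + 9 - δ) (weaveRank k δ) (weaveTime k δ) (t + 1) (p + 1) (q - 1) :=
    (weaveAt_one (b := 1) (by omega) (by omega)).linked_arm hδ
      (weaveAt_two (by omega) (by omega)) (Or.inl (by omega)) (Or.inl (by omega)) (by omega)
  have h₃ : Linked (9 * k + 9 - δ) (weaveRank k δ) (weaveTime k δ) t (p - 1) q :=
    (weaveAt_zero (b := 0) (by omega) (by omega)).linked_arm hδ
      (weaveAt_two (by omega) (by omega)) (Or.inl (by omega)) (Or.inr (by omega)) (by omega)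
  have hc := (weaveAt_zero (k := k) (δ := δ) (p := p - 1) (b := 0) (by omega)
    (by omega)).cut_arm (t := t + 1) hδ (weaveAt_zero (p := p - 1) (by omega) (by omega))
    (weaveAt_two (p := q) (by omega) (by omega)) (by omega)
  rw [weave_plain hδ (weaveAt_one (p := p) (b := 0) (by omega) (by omega)) rfl
      (Or.inr (by omega)) (by omega), weave_last hδ hq]
  exact separated_of_perm (.refl _) (List.Perm.swap _ _ _) (separated_pair h₁ h₃ _ hc)

/-- The final cut of the quotient, between `x₁` and `x₂`. -/
theorem weave_separated_end (hδ : δ ≤ 1) (hp : p + 3 * δ = 6 * k + 6)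
    (hq : q + 2 * δ = 6 * k + 7) (ht : t = p + 3 * k + 2 * δ) :
    WeaveSeparated k δ t ((weave k δ).pairNb p) ((weave k δ).pairNb q) := by
  have h₁ : Linked (9 * k + 9 - δ) (weaveRank k δ) (weaveTime k δ) (t + 1) (p + 1) (q - 1) := by
    obtain rfl | rfl : δ = 0 ∨ δ = 1 := by omega
    · exact (weaveAt_two (b := 3 * k + 1) (by omega) (by omega)).linked_arm hδ
        (weaveAt_one (by omega) (by omega)) (Or.inl (by omega)) (Or.inl (by omega)) (by omega)
    · rw [show q - 1 = p + 1 by omega]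
      exact Linked.refl _
  have h₃ : Linked (9 * k + 9 - δ) (weaveRank k δ) (weaveTime k δ) t (p - 1) (q + 1) :=
    (weaveAt_one (b := 3 * k) (by omega) (by omega)).linked_arm hδ
      (weaveAt_two (by omega) (by omega)) (Or.inl (by omega)) (Or.inl (by omega)) (by omega)
  have hc := (weaveAt_one (k := k) (δ := δ) (p := p - 1) (b := 3 * k) (by omega)
    (by omega)).cut_arm (t := t + 1) hδ (weaveAt_one (p := p - 1) (by omega) (by omega))
    (weaveAt_two (p := q + 1) (by omega) (by omega)) (by omega)
  rw [weave_x₁ hδ hp, weave_x₂ hδ hq]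
  exact separated_of_perm (.refl _) (List.Perm.swap _ _ _)
    (separated_triple h₁ (Linked.refl _) h₃ _ hc)

end Weave

section Weave

variable {k δ : ℕ}

theorem weave_separated (hδ : δ ≤ 1) : ∀ p < 9 * k + 9 - δ, p ≠ 9 * k + 7 - 2 * δ → ∀ t,
    weaveTime k δ p = t + 2 →
      WeaveSeparated k δ t ((weave k δ).pairNb p) ((weave k δ).pairNb (weaveNext k δ p)) := by
  intro p hp hpz t ht
  have hP := weaveAt (k := k) (p := p) hδ (by omega)
  generalize weaveLevel k δ p = b at hP
  generalize weaveArm k δ p = a at hP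
  obtain ⟨b', a', hQ, H⟩ := hP.next_at hδ (by omega)
  have hT := hP.time_spec hδ
  generalize weaveNext k δ p = q at hQ
  rcases H with ⟨rfl, -⟩ | ⟨h1, h2, rfl, rfl⟩ | ⟨h1, rfl, h3, rfl, rfl⟩ | ⟨h1, rfl, h3, h4, rfl⟩ |
    ⟨h1, rfl, h3, h4, rfl⟩
  · omega
  · replace hT : t = p + 3 * k + 2 * δ := by
      clear hQ
      omega
    by_cases c1 : b' = 3 * k + 2
    · obtain rfl : δ = 0 := by
        clear hQ
        omega
      obtain rfl : p = 2 := by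
        clear hQ
        omega
      obtain rfl : a = 1 := by
        clear hQ
        omega
      obtain rfl : q = 0 := by
        clear hP
        omega
      exact weave_separated_second (by omega)
    obtain rfl | rfl : a = 0 ∨ a = 1 := by omega
    · replace hP : p + b' + 3 * δ = 3 * k + 4 := by
        clear hQ
        omega
      replace hQ : q + 3 * δ = 3 * k + 5 + b' := by omega
      by_cases c2 : b' = 3 * k + 1
      · obtain rfl | rfl : δ = 0 ∨ δ = 1 := by omega
        · obtain rfl : p = 3 := by omega
          obtain rfl : q = 6 * k + 6 := by omega
          exact weave_separated_third (by omega)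
        · obtain rfl : p = 0 := by omega
          obtain rfl : q = 6 * k + 3 := by omega
          exact weave_separated_start (by omega)
      by_cases c3 : b' = 0
      · obtain rfl : q = p + 1 := by omega
        exact weave_separated_first_turn hδ (by omega) hT
      · exact weave_separated_first_arm hδ (by omega) (by omega) hP hQ hT
    · replace hP : p + 3 * δ = 3 * k + 5 + b' := by
        clear hQ
        omega
      replace hQ : q + b' + 1 + 2 * δ = 9 * k + 9 := by omega
      by_cases c2 : b' = 3 * k + 1
      · exact weave_separated_end hδ (by omega) (by omega) hT
      by_cases c3 : b' = 0
      · exact weave_separated_second_turn hδ (by omega) (by omega) hT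
      · exact weave_separated_second_arm hδ (by omega) (by omega) hP hQ hT
  · obtain rfl : t = b := by omega
    replace hP : p + t + 1 + 2 * δ = 9 * k + 9 := by
      clear hQ
      omega
    by_cases c1 : t = 0
    · subst c1
      exact weave_separated_last hδ hP hQ
    · exact weave_separated_zero_mod_three hδ (by omega) h3 h1 hP hQ
  · replace hP : p + b + 1 + 2 * δ = 9 * k + 9 := by
      clear hQ
      omega
    have h5 : t + 2 = b := by
      clear hQ
      omega
    have h6 : 4 ≤ b := by
      clear hQ
      omega
    exact weave_separated_one_mod_three hδ h6 h3 h1 hP (by omega) h5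
  · have h5 : t + 1 = b := by
      clear hQ
      omega
    by_cases c1 : b = 3 * k + 2
    · subst c1
      exact weave_separated_top hδ hP (by clear hP; omega) (by omega)
    · exact weave_separated_two_mod_three hδ h3 (by omega) (by clear hQ; omega)
        (by clear hP; omega) h5

theorem weave_certificate (hδ : δ ≤ 1) :
    SplitCertificate (9 * k + 9 - δ) (weave k δ).pairNb (weaveRank k δ) (weaveTime k δ)
      (weaveNext k δ) (9 * k + 7 - 2 * δ) :=
  SplitCertificate.of_separated (by omega) (weave_rank_inj hδ) (weave_rank_le hδ) (weave_next hδ)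
    (weave_time_inj hδ) (fun _ hp hpz ht => weave_first hδ hp hpz ht) (weave_separated hδ)

theorem length_pairNb_weave (hδ : δ ≤ 1) {p : ℕ} (hp : p < 9 * k + 9 - δ) :
    ((weave k δ).pairNb p).length = 2 ∨ ((weave k δ).pairNb p).length = 3 := by
  by_cases c1 : p = 0
  · rw [c1, weave_zero hδ]
    exact Or.inr rfl
  by_cases c2 : p + 3 * δ = 6 * k + 6
  · rw [weave_x₁ hδ c2]
    exact Or.inr rfl
  by_cases c3 : p + 2 * δ = 6 * k + 7
  · rw [weave_x₂ hδ c3]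
    exact Or.inr rfl
  by_cases c4 : p + 1 + 2 * δ = 9 * k + 9
  · rw [weave_last hδ c4]
    exact Or.inl rfl
  by_cases c5 : δ = 1 ∧ p = 6 * k + 4
  · rw [weave_middle c5.1 c5.2]
    exact Or.inr rfl
  by_cases c6 : δ = 1 ∧ p = 9 * k + 7
  · rw [weave_single c6.1 c6.2]
    exact Or.inl rfl
  have hP := weaveAt (k := k) (p := p) hδ (by omega)
  generalize weaveLevel k δ p = b at hP
  generalize weaveArm k δ p = a at hP
  by_cases c7 : b % 3 = 0
  · rw [weave_plain hδ hP c7 (by omega) (by omega)]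
    exact Or.inl rfl
  · rw [weave_loop hδ hP (by omega) (by omega)]
    exact Or.inr rfl

theorem existsLongRefinementTwoThree_weave (hδ : δ ≤ 1) :
    ExistsLongRefinementTwoThree (18 * k + 18 - 3 * δ) := by
  have hN : (weave k δ).len + (weave k δ).single = 9 * k + 9 - δ := by
    simp only [weave]
    omega
  have key := existsLongRefinementTwoThree (D := weave k δ) (ρ := weaveRank k δ)
    (τ := weaveTime k δ) (nx := weaveNext k δ) (z := 9 * k + 7 - 2 * δ) (weave_valid hδ)
  rw [hN] at key
  have h := key (weave_certificate hδ) (by simp only [weave]; omega)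
    ((weaveAt_one (b := 3 * k + 1) le_rfl (by simp only [weave]; omega)).linked_arm hδ
      (weaveAt_two (b := 3 * k + 1) le_rfl (by simp only [weave]; omega)) (Or.inl le_rfl)
      (Or.inl (by omega)) (by omega))
    (fun p hp => length_pairNb_weave hδ hp)
    ⟨9 * k + 8 - 2 * δ, by omega, by rw [weave_last hδ (by omega)]; rfl⟩
  rwa [show 2 * (weave k δ).len + (weave k δ).single = 18 * k + 18 - 3 * δ by
    simp only [weave]; omega] at h

end Weave

end PairString

/-! ### A graph of order 12 -/

theorem rel_of_forall₂_perm {R : ℕ → ℕ → Prop} {l m l' : List ℕ} (h : List.Forall₂ R l m)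
    (hm : m.Perm l') : Multiset.Rel R (l : Multiset ℕ) (l' : Multiset ℕ) := by
  rw [← Multiset.coe_eq_coe.2 hm]
  clear hm
  induction h with
  | nil => exact Multiset.Rel.zero
  | cons hab _ ih => exact PairString.rel_coe_cons hab ih

instance (N : ℕ) (ρ τ : ℕ → ℕ) (t : ℕ) : DecidableRel (Linked N ρ τ t) := fun p q =>
  inferInstanceAs (Decidable (∀ x < N, min (ρ p) (ρ q) ≤ ρ x → ρ x < max (ρ p) (ρ q) → t < τ x))

namespace TwelveVertices

/-- The neighbours in a graph on twelve vertices. -/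
def nb (v : ℕ) : List ℕ :=
  [[2, 4], [3, 5], [0, 3, 6], [1, 2, 7], [0, 8, 9], [1, 10, 11], [2, 7, 8], [3, 6, 9], [4, 6, 10], [4, 7, 11], [5, 8, 11], [5, 9, 10]].getD v []

/-- The time of the cut between `v` and `v + 1`. -/
def time (v : ℕ) : ℕ :=
  [7, 1, 8, 3, 6, 2, 9, 4, 10, 5, 11, 12].getD v 0

/-- The neighbours of `v + 1`, in an order that matches the neighbours of `v`. -/
def nextNb (v : ℕ) : List ℕ :=
  -- The entry for `1` is empty since the cut after `1` has time one and needs no matching; the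
  -- entry for `11` is empty since `11` is the last node.
  [[3, 5], [], [1, 2, 7], [0, 8, 9], [1, 10, 11], [2, 7, 8], [3, 6, 9], [4, 6, 10], [4, 7, 11], [5, 8, 11], [5, 9, 10], []].getD v []

/-- The vertices are numbered in the final order of the classes, so the rank is the identity and the
successor is `p + 1`. The explicit matching makes all conditions decidable. -/
theorem certificate : SplitCertificate 12 nb id time (· + 1) 11 where
  last_lt := by decide
  rank_inj := by decide
  rank_le_last := by decide
  next_lt := by decide
  lt_rank_next := by decide
  rank_next_le := by decide
  time_pos := by decide
  time_lt := by decide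
  time_inj := by decide
  matched := by
    have key : ∀ p < 12, p ≠ 11 → 2 ≤ time p →
        List.Forall₂ (Linked 12 id time (time p - 2)) (nb p) (nextNb p) ∧
          (nextNb p).Perm (nb (p + 1)) := by
      decide
    exact fun p hp hpz ht => rel_of_forall₂_perm (key p hp hpz ht).1 (key p hp hpz ht).2
  unmatched := by decide

/-- The graph on twelve vertices with neighbours `nb`. -/
def graph : SimpleGraph (Fin 12) where
  Adj v w := (w : ℕ) ∈ nb v
  symm := ⟨by decide⟩
  loopless := ⟨by decide⟩

instance : DecidableRel graph.Adj := fun v w => inferInstanceAs (Decidable ((w : ℕ) ∈ nb v))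

theorem neighborFinset_graph (v : Fin 12) :
    (graph.neighborFinset v).val.map Fin.val = (nb v : Multiset ℕ) := by
  revert v
  decide

theorem existsLongRefinementTwoThree : ExistsLongRefinementTwoThree 12 := by
  refine ⟨Fin 12, inferInstance, graph, inferInstance, rfl,
    certificate.isLongRefinement neighborFinset_graph, ?_⟩
  have h : ∀ v, graph.degree v = 2 ∨ graph.degree v = 3 := by decide
  ext d
  constructor
  · rintro ⟨v, rfl⟩
    exact h v
  · rintro (rfl | rfl)
    · exact ⟨0, by decide⟩
    · exact ⟨2, by decide⟩

end TwelveVertices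

/-! ### Assembling the residue classes -/

theorem mainTheorem5 :
    (∀ n : ℕ, Even n → 12 ≤ n → (n = 12 ∨ n % 18 ∉ ({6, 12} : Set ℕ)) →
      ExistsLongRefinementTwoThree n) ∧
    (∀ n : ℕ, Odd n → 11 ≤ n → n % 18 ∉ ({3, 9} : Set ℕ) →
      ExistsLongRefinementTwoThree n) ∧
    (∀ n : ℕ, 11 ≤ n → (n = 12 ∨ n % 18 ∉ ({3, 6, 9, 12} : Set ℕ)) →
      ExistsLongRefinementTwoThree n) := by
  have key : ∀ n : ℕ, 11 ≤ n →
      (n = 12 ∨ (n % 18 ≠ 3 ∧ n % 18 ≠ 6 ∧ n % 18 ≠ 9 ∧ n % 18 ≠ 12)) →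
      ExistsLongRefinementTwoThree n := by
    intro n hn h
    rcases h with rfl | h
    · exact TwelveVertices.existsLongRefinementTwoThree
    have fold := fun m δ e => @PairString.existsLongRefinementTwoThree_fold m δ e
    have weave := fun k δ => @PairString.existsLongRefinementTwoThree_weave k δ
    -- The residues 1, 2, 4, 5 modulo 6 belong to `fold`. Among multiples of three, the hypothesis
    -- leaves only 0 and 15 modulo 18, which belong to `weave`.
    obtain ⟨m, c | c | c | c⟩ | ⟨k, c | c⟩ :
        (∃ m, n = 6 * m + 2 ∨ n = 6 * m + 4 ∨ n = 6 * m + 5 ∨ n = 6 * m + 7) ∨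
        (∃ k, n = 18 * k + 18 ∨ n = 18 * k + 15) := by
      by_cases h6 : n % 6 = 0
      · exact Or.inr ⟨(n - 18) / 18, by omega⟩
      by_cases h3 : n % 6 = 3
      · exact Or.inr ⟨(n - 15) / 18, by omega⟩
      by_cases h1 : n % 6 = 1
      · exact Or.inl ⟨(n - 7) / 6, by omega⟩
      · exact Or.inl ⟨(n - 2) / 6, by omega⟩
    · rw [show n = 2 * (3 * m + 0 + 1) + 0 by omega]
      exact fold m 0 1 (by constructor <;> omega)
    · rw [show n = 2 * (3 * m + 0 + 2) + 0 by omega]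
      exact fold m 0 2 (by constructor <;> omega)
    · rw [show n = 2 * (3 * m + 1 + 1) + 1 by omega]
      exact fold m 1 1 (by constructor <;> omega)
    · rw [show n = 2 * (3 * m + 1 + 2) + 1 by omega]
      exact fold m 1 2 (by constructor <;> omega)
    · rw [show n = 18 * k + 18 - 3 * 0 by omega]
      exact weave k 0 (by omega)
    · rw [show n = 18 * k + 18 - 3 * 1 by omega]
      exact weave k 1 (by omega)
  simp only [Set.mem_insert_iff, Set.mem_singleton_iff, not_or]
  refine ⟨fun n he hn h => key n (by omega) ?_, fun n ho hn h => key n hn ?_,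
    fun n hn h => key n hn h⟩
  · obtain ⟨m, rfl⟩ := he
    omega
  · obtain ⟨m, rfl⟩ := ho
    omega
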